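/- Let $m\in\mathbb N$ and $1\le s\le k$ be integers. Let $B:\mathbb R^m\to\mathbb R^{m\times m}$ and $H,C:\mathbb R^m\to\mathbb R$ be $C^\infty$, with $B(y)^\top=-B(y)$ and $\nabla C(y)^\top B(y)=0$ for all $y$ (i.e. $C$ is a Casimir of the Poisson problem $\dot y=B(y)\nabla H(y)$, $y(0)=y_0$), and let $\tilde B^\top=-\tilde B\neq O$ be a constant matrix. Let $P_0,P_1,\dots$ be the orthonormal Legendre polynomials on $[0,1]$, and let $c_1,\dots,c_k$ and $b_1,\dots,b_k$ be the abscissae (the zeros of $P_k$) and weights of the $k$-point Gauss-Legendre (interpolatory) quadrature rule on $[0,1]$. For $u:[0,h]\to\mathbb R^m$ and $i,j=0,\dots,s-1$ put $$\hat\gamma_j(u)=\sum_{\ell=1}^k b_\ell P_j(c_\ell)\nabla H(u(c_\ell h)),\quad \hat\pi_i(u)=\sum_{\ell=1}^k b_\ell P_i(c_\ell)\nabla C(u(c_\ell h)),\quad \hat\rho_{ij}(u)=\sum_{\ell=1}^k b_\ell P_i(c_\ell)P_j(c_\ell)B(u(c_\ell h)).$$ A step of size $h>0$ of the method EPHBVM$(k,s)$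 from $y_0$ is a pair $(u,\alpha)$ with $u(0)=y_0$, $$\dot u(ch)=\sum_{i,j=0}^{s-1}P_i(c)\hat\rho_{ij}(u)\hat\gamma_j(u)-\alpha\tilde B\hat\gamma_0(u)\quad(c\in[0,1]),\qquad \alpha=\frac{\sum_{i,j=0}^{s-1}\hat\pi_i(u)^\top\hat\rho_{ij}(u)\hat\gamma_j(u)}{\hat\pi_0(u)^\top\tilde B\hat\gamma_0(u)},$$ where the denominator is nonzero; the new approximation is $y_1=u(h)$. Then: 1. If $C$ is a polynomial of degree at most $2k/s$, then $C(y_1)-C(y_0)=0$ for every step of any size $h>0$. 2. In general $C(y_1)-C(y_0)=O(h^{2k+1})$ as $h\to0^+$, along steps for which $u$ and $\alpha$ remain bounded: for all $R,K$ there are $M$ and $h_0>0$ such that $|C(y_1)-C(y_0)|\le Mh^{2k+1}$ for every step of size $0<h\le h_0$ with $\|u(t)\|\le R$ on $[0,h]$ and $|\alpha|\le K$. 3. If moreover $\nabla C(y_0)^\top\tilde B\,\nabla H(y_0)\ne0$, then there are $r>0$, $M$ and $h_0>0$ such that every step of size $0<h\le h_0$ with $\|u(t)-y_0\|\le r$ on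 $[0,h]$ satisfies $|\alpha|\le Mh^{2s}$ and $|C(y_1)-C(y_0)|\le Mh^{2k+1}$. -/

import Mathlib

open scoped ContDiff

noncomputable section

namespace EPHBVM

/-- The orthonormal Legendre polynomial of degree `j` on `[0,1]`, normalised so that its value
at `1` is positive; in particular `legendre 0 = 1`. -/
def legendre (j : ℕ) : Polynomial ℝ :=
  Polynomial.C (Real.sqrt (2 * (j : ℝ) + 1) * (-1) ^ j) *
    (Polynomial.shiftedLegendre j).map (Int.castRingHom ℝ)

/-- The Gauss-Legendre abscissae on `[0,1]`: the (real, simple) zeros of the Legendre polynomial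
of degree `k`. -/
def nodes (k : ℕ) : Finset ℝ := (legendre k).roots.toFinset

/-- The weight of the interpolatory quadrature rule on `[0,1]` at the abscissa `c`, i.e. the
integral of the Lagrange basis polynomial attached to `c`. -/
def weight (k : ℕ) (c : ℝ) : ℝ :=
  ∫ x in (0 : ℝ)..1, (Lagrange.basis (nodes k) (fun x : ℝ => x) c).eval x

/-- The `k`-point Gauss-Legendre quadrature of `f` on `[0,1]`. -/
def quad {V : Type*} [AddCommGroup V] [Module ℝ V] (k : ℕ) (f : ℝ → V) : V :=
  ∑ c ∈ nodes k, weight k c • f c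

section Method

variable {m : ℕ}

/-- The discrete Fourier coefficient `∑_ℓ b_ℓ P_j(c_ℓ) ∇F(u(c_ℓ h))` of the gradient of a scalar
function `F` along `u`: it is `γ̂_j(u)` for `F = H` and `π̂_j(u)` for `F = C`. -/
def gradCoeff (k : ℕ) (F : EuclideanSpace ℝ (Fin m) → ℝ) (h : ℝ)
    (u : ℝ → EuclideanSpace ℝ (Fin m)) (j : ℕ) : EuclideanSpace ℝ (Fin m) :=
  quad k fun c => (legendre j).eval c • gradient F (u (c * h))

/-- The discrete Fourier coefficient `ρ̂_{ij}(u) = ∑_ℓ b_ℓ P_i(c_ℓ) P_j(c_ℓ) B(u(c_ℓ h))`. -/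
def matCoeff (k : ℕ) (B : EuclideanSpace ℝ (Fin m) → Matrix (Fin m) (Fin m) ℝ) (h : ℝ)
    (u : ℝ → EuclideanSpace ℝ (Fin m)) (i j : ℕ) : Matrix (Fin m) (Fin m) ℝ :=
  quad k fun c => ((legendre i).eval c * (legendre j).eval c) • B (u (c * h))

/-- `u : [0,h] → ℝ^m` and `α : ℝ` solve the equations of one step, of size `h` and from `y₀`, of
the enhanced Poisson Hamiltonian boundary value method with parameters `(k,s)`, for the problem
`y' = B(y) ∇H(y)`, the Casimir `C` and the constant matrix `Bt`. The new approximation is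
`u h`. -/
structure IsStep (k s : ℕ) (B : EuclideanSpace ℝ (Fin m) → Matrix (Fin m) (Fin m) ℝ)
    (H C : EuclideanSpace ℝ (Fin m) → ℝ) (Bt : Matrix (Fin m) (Fin m) ℝ)
    (y₀ : EuclideanSpace ℝ (Fin m)) (h : ℝ) (u : ℝ → EuclideanSpace ℝ (Fin m)) (α : ℝ) :
    Prop where
  init : u 0 = y₀
  ode : ∀ c ∈ Set.Icc (0 : ℝ) 1,
    HasDerivWithinAt u
      ((∑ i ∈ Finset.range s, ∑ j ∈ Finset.range s, (legendre i).eval c •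
          Matrix.toEuclideanLin (matCoeff k B h u i j) (gradCoeff k H h u j))
        - α • Matrix.toEuclideanLin Bt (gradCoeff k H h u 0))
      (Set.Icc 0 h) (c * h)
  den_ne_zero :
    inner ℝ (gradCoeff k C h u 0) (Matrix.toEuclideanLin Bt (gradCoeff k H h u 0)) ≠ 0
  alpha_eq : α =
    (∑ i ∈ Finset.range s, ∑ j ∈ Finset.range s,
        inner ℝ (gradCoeff k C h u i)
          (Matrix.toEuclideanLin (matCoeff k B h u i j) (gradCoeff k H h u j))) /
      inner ℝ (gradCoeff k C h u 0) (Matrix.toEuclideanLin Bt (gradCoeff k H h u 0))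

end Method

end EPHBVM

end

/-! In rescaled time `σ c = u (c * h)` the step is a polynomial curve of degree at most `s` with `σ'
= h ∑ P_i v_i`. The Gauss rule applied to `(C ∘ σ)'` gives `h ∑ ⟨π̂_i, v_i⟩`, and `α` is chosen
exactly so that this sum vanishes (`sum_inner_stageCoeff_eq_zero`). Hence `C(y₁) - C(y₀)` is nothing
but the Gauss quadrature error for `(C ∘ σ)'`. For a polynomial Casimir the integrand has degree
below `2k`, where the rule is exact. In general the error is controlled by the derivative of order
`2k + 1` of `C ∘ σ`.

That derivative is `O(h^(2k+1))` because the derivative of order `i` of `σ` is `O(h^i)`, which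
`exists_slowCurve` proves by a bootstrap. If it holds up to order `N`, discrete orthogonality makes
`v_i = O(h^N)` for `i ≥ N`; differentiating `∑ P_i v_i` another `N` times removes the terms with `i
< N`, and the prefactor `h` yields order `N + 1`.

For the size of `α`, the numerator is the quadrature of `⟨pκ, a(pg)⟩`, where `p` is the discrete
Legendre projection and `κ`, `a`, `g` are `∇C`, `B`, `∇H` along `σ`. Since `κᵀa = 0`, it can be
rewritten as a product of two projection errors, each `O(h^s)`, while the denominator stays away
from zero near `y₀`. -/

noncomputable section

namespace EPHBVM

open Polynomial intervalIntegral

/-! ### Legendre polynomials -/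

/-- The integral over `[0,1]` of a polynomial. -/
def unitIntegral (p : ℝ[X]) : ℝ := ∫ x in (0 : ℝ)..1, p.eval x

theorem intervalIntegrable_eval (p : ℝ[X]) (a b : ℝ) :
    IntervalIntegrable (fun x => p.eval x) MeasureTheory.volume a b :=
  p.continuous.intervalIntegrable _ _

theorem unitIntegral_add (p q : ℝ[X]) :
    unitIntegral (p + q) = unitIntegral p + unitIntegral q := by
  simp only [unitIntegral, eval_add]
  exact integral_add (intervalIntegrable_eval p _ _) (intervalIntegrable_eval q _ _)

theorem unitIntegral_C_mul (a : ℝ) (p : ℝ[X]) :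
    unitIntegral (C a * p) = a * unitIntegral p := by
  simp [unitIntegral]

theorem unitIntegral_sum {ι : Type*} (t : Finset ι) (p : ι → ℝ[X]) :
    unitIntegral (∑ i ∈ t, p i) = ∑ i ∈ t, unitIntegral (p i) := by
  simp only [unitIntegral, eval_finsetSum]
  exact integral_finsetSum fun i _ => intervalIntegrable_eval (p i) _ _

theorem unitIntegral_derivative (p : ℝ[X]) :
    unitIntegral (derivative p) = p.eval 1 - p.eval 0 :=
  integral_eq_sub_of_hasDerivAt (fun x _ => p.hasDerivAt x)
    (intervalIntegrable_eval (derivative p) _ _)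

/-- The polynomial `x ^ n * (1 - x) ^ n` of the formula of Rodrigues. -/
def rodrigues (n : ℕ) : ℝ[X] := X ^ n * (1 - X) ^ n

theorem factorial_smul_map_shiftedLegendre (n : ℕ) :
    C (n.factorial : ℝ) * (shiftedLegendre n).map (Int.castRingHom ℝ) =
      derivative^[n] (rodrigues n) := by
  have h := congrArg (Polynomial.map (Int.castRingHom ℝ)) (factorial_mul_shiftedLegendre_eq n)
  rw [Polynomial.map_mul, ← Polynomial.iterate_derivative_map] at h
  simpa [rodrigues] using h

/-- Each differentiation lowers the multiplicity `n` of the root by at most one. These values are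
the boundary terms in the repeated integration by parts. -/
theorem eval_zero_iterate_derivative_rodrigues {n j : ℕ} (hj : j < n) :
    (derivative^[j] (rodrigues n)).eval 0 = 0 := by
  have h : X ^ n ∣ rodrigues n := Dvd.intro _ rfl
  have h2 := pow_sub_dvd_iterate_derivative_of_pow_dvd j h
  exact eval_eq_zero_of_dvd_of_eval_eq_zero h2 (by simp; omega)

theorem eval_one_iterate_derivative_rodrigues {n j : ℕ} (hj : j < n) :
    (derivative^[j] (rodrigues n)).eval 1 = 0 := by
  have h : (1 - X) ^ n ∣ rodrigues n := Dvd.intro_left _ rfl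
  have h2 := pow_sub_dvd_iterate_derivative_of_pow_dvd j h
  exact eval_eq_zero_of_dvd_of_eval_eq_zero h2 (by simp; omega)

/-- Integration by parts moves one derivative onto `q` and lowers its degree; the boundary terms
vanish. -/
theorem unitIntegral_iterate_derivative_rodrigues_mul {n : ℕ} :
    ∀ {j : ℕ}, j ≤ n → ∀ q : ℝ[X], q.degree < j →
      unitIntegral (derivative^[j] (rodrigues n) * q) = 0
  | 0, _, q, hq => by
    have : q = 0 := by
      rw [← degree_eq_bot]
      exact Nat.WithBot.lt_zero_iff.mp (by simpa using hq)
    simp [this, unitIntegral]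
  | j + 1, hj, q, hq => by
    have hq' : (derivative q).degree < j := by
      by_cases h0 : q = 0
      · simp [h0]
      rcases Nat.eq_zero_or_pos q.natDegree with h | h
      · rw [eq_C_of_natDegree_eq_zero h]; simp
      · have := natDegree_lt_iff_degree_lt h0 |>.mpr hq
        have h2 := natDegree_derivative_lt h.ne'
        refine (degree_le_natDegree).trans_lt ?_
        exact_mod_cast (by omega : (derivative q).natDegree < j)
    have h1 := unitIntegral_derivative (derivative^[j] (rodrigues n) * q)
    rw [derivative_mul, unitIntegral_add,
      unitIntegral_iterate_derivative_rodrigues_mul (by omega) _ hq', eval_mul, eval_mul,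
      eval_zero_iterate_derivative_rodrigues (by omega),
      eval_one_iterate_derivative_rodrigues (by omega)] at h1
    rw [Function.iterate_succ_apply']
    simpa using h1

theorem degree_map_shiftedLegendre (n : ℕ) :
    ((shiftedLegendre n).map (Int.castRingHom ℝ)).degree = n := by
  rw [degree_map_eq_of_injective (RingHom.injective_int _), degree_shiftedLegendre]

theorem legendre_factor_ne_zero (n : ℕ) : Real.sqrt (2 * (n : ℝ) + 1) * (-1) ^ n ≠ 0 := by
  have : Real.sqrt (2 * (n : ℝ) + 1) ≠ 0 := by positivity
  simp [this]

theorem degree_legendre (n : ℕ) : (legendre n).degree = n := by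
  rw [legendre, degree_C_mul (legendre_factor_ne_zero n), degree_map_shiftedLegendre]

theorem natDegree_legendre (n : ℕ) : (legendre n).natDegree = n :=
  natDegree_eq_of_degree_eq_some (degree_legendre n)

theorem legendre_ne_zero (n : ℕ) : legendre n ≠ 0 := by
  intro h
  have := degree_legendre n
  simp [h] at this

theorem legendre_zero : legendre 0 = 1 := by
  simp [legendre, shiftedLegendre]

theorem factorial_mul_legendre (n : ℕ) :
    C (n.factorial : ℝ) * legendre n =
      C (Real.sqrt (2 * (n : ℝ) + 1) * (-1) ^ n) * derivative^[n] (rodrigues n) := by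
  rw [← factorial_smul_map_shiftedLegendre, legendre]
  ring

theorem unitIntegral_legendre_mul {n : ℕ} {q : ℝ[X]} (hq : q.degree < n) :
    unitIntegral (legendre n * q) = 0 := by
  have h := unitIntegral_iterate_derivative_rodrigues_mul le_rfl q hq
  have h2 : unitIntegral (C (n.factorial : ℝ) * (legendre n * q)) = 0 := by
    rw [← mul_assoc, factorial_mul_legendre, mul_assoc, unitIntegral_C_mul, h, mul_zero]
  rw [unitIntegral_C_mul] at h2
  exact (mul_eq_zero.mp h2).resolve_left (by positivity)

theorem eval_map_shiftedLegendre (n : ℕ) (x : ℝ) :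
    ((shiftedLegendre n).map (Int.castRingHom ℝ)).eval x =
      ∑ k ∈ Finset.range (n + 1), n.choose k * (n + k).choose n * (-x) ^ k := by
  simp only [shiftedLegendre, Polynomial.map_sum, eval_finsetSum]
  refine Finset.sum_congr rfl fun k _ => ?_
  rw [neg_pow x]
  simp
  ring

theorem eval_map_shiftedLegendre_symm (n : ℕ) (x : ℝ) :
    ((shiftedLegendre n).map (Int.castRingHom ℝ)).eval x =
      (-1) ^ n * ((shiftedLegendre n).map (Int.castRingHom ℝ)).eval (1 - x) := by
  have h := shiftedLegendre_eval_symm n x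
  rwa [aeval_def, aeval_def, ← eval_map, ← eval_map] at h

/-- In powers of `-x` all coefficients are positive. With the symmetry `x ↦ 1 - x` this confines the
roots to `[0,1]`. -/
theorem eval_map_shiftedLegendre_pos (n : ℕ) {x : ℝ} (hx : x ≤ 0) :
    0 < ((shiftedLegendre n).map (Int.castRingHom ℝ)).eval x := by
  rw [eval_map_shiftedLegendre, Finset.sum_range_succ']
  refine add_pos_of_nonneg_of_pos (Finset.sum_nonneg fun k _ => ?_) (by simp)
  have : 0 ≤ -x := by linarith
  positivity

theorem eval_legendre (n : ℕ) (x : ℝ) : (legendre n).eval x =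
    Real.sqrt (2 * (n : ℝ) + 1) * (-1) ^ n *
      ((shiftedLegendre n).map (Int.castRingHom ℝ)).eval x := by
  simp [legendre]

theorem eval_one_legendre (n : ℕ) : (legendre n).eval 1 = Real.sqrt (2 * (n : ℝ) + 1) := by
  have h0 : ((shiftedLegendre n).map (Int.castRingHom ℝ)).eval 0 = 1 := by
    rw [eval_map_shiftedLegendre, Finset.sum_range_succ']
    simp
  rw [eval_legendre, eval_map_shiftedLegendre_symm, sub_self, h0, mul_one, mul_assoc, ← mul_pow]
  simp

theorem mem_Icc_of_isRoot_legendre {n : ℕ} {x : ℝ} (hx : (legendre n).eval x = 0) :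
    x ∈ Set.Icc (0 : ℝ) 1 := by
  rw [eval_legendre] at hx
  have h := (mul_eq_zero.mp hx).resolve_left (legendre_factor_ne_zero n)
  constructor <;> by_contra! hlt
  · exact (eval_map_shiftedLegendre_pos n hlt.le).ne' h
  · rw [eval_map_shiftedLegendre_symm] at h
    have := eval_map_shiftedLegendre_pos n (x := 1 - x) (by linarith)
    simp [this.ne'] at h

/-- Integrate `(x P²)' = (2n+1) P² + 2 P (x P' - n P)`. The leading terms of `x P' - n P` cancel, so
the last product integrates to zero, and the boundary value is `P(1)² = 2n+1`. -/
theorem unitIntegral_legendre_sq (n : ℕ) : unitIntegral (legendre n * legendre n) = 1 := by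
  have hdeg : (X * derivative (legendre n) - C (n : ℝ) * legendre n).degree < (n : WithBot ℕ) := by
    rw [degree_lt_iff_coeff_zero]
    intro m hm
    rcases hm.eq_or_lt with rfl | hlt
    · cases n with
      | zero => simp
      | succ n =>
        rw [coeff_sub, coeff_X_mul, coeff_derivative, coeff_C_mul]
        push_cast
        ring
    · cases m with
      | zero => omega
      | succ m =>
        simp [coeff_X_mul, coeff_derivative,
          coeff_eq_zero_of_natDegree_lt (show (legendre n).natDegree < m + 1 by
            rw [natDegree_legendre]; exact hlt)]
  have h1 := unitIntegral_derivative (X * (legendre n * legendre n))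
  have h2 : derivative (X * (legendre n * legendre n)) =
      C (2 * (n : ℝ) + 1) * (legendre n * legendre n) +
        C 2 * (legendre n * (X * derivative (legendre n) - C (n : ℝ) * legendre n)) := by
    simp only [derivative_mul, derivative_X, C_add, C_mul, C_1]
    have : (C 2 : ℝ[X]) = 2 := rfl
    rw [this]
    ring
  rw [h2, unitIntegral_add, unitIntegral_C_mul, unitIntegral_C_mul,
    unitIntegral_legendre_mul hdeg, mul_zero, add_zero] at h1
  simp only [eval_mul, eval_X, one_mul, zero_mul, sub_zero, eval_one_legendre] at h1
  rw [Real.mul_self_sqrt (by positivity)] at h1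
  have h3 : (2 * (n : ℝ) + 1) ≠ 0 := by positivity
  exact mul_left_cancel₀ h3 (by rw [h1, mul_one])

theorem unitIntegral_legendre_mul_legendre (i j : ℕ) :
    unitIntegral (legendre i * legendre j) = if i = j then 1 else 0 := by
  rcases lt_trichotomy i j with h | rfl | h
  · rw [if_neg h.ne, mul_comm]
    exact unitIntegral_legendre_mul (by rw [degree_legendre]; exact_mod_cast h)
  · simp [unitIntegral_legendre_sq]
  · rw [if_neg h.ne']
    exact unitIntegral_legendre_mul (by rw [degree_legendre]; exact_mod_cast h)

/-! ### Gauss-Legendre quadrature -/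

theorem iterate_derivative_rodrigues_ne_zero {n j : ℕ} (hj : j ≤ n) :
    derivative^[j] (rodrigues n) ≠ 0 := by
  intro h
  have h1 : derivative^[n] (rodrigues n) = 0 := by
    obtain ⟨d, rfl⟩ := Nat.exists_eq_add_of_le' hj
    rw [Function.iterate_add_apply, h, iterate_derivative_zero]
  have h2 := factorial_mul_legendre n
  rw [h1, mul_zero, mul_eq_zero] at h2
  rcases h2 with h2 | h2
  · rw [C_eq_zero] at h2
    exact absurd h2 (by positivity)
  · exact legendre_ne_zero n h2

/-- Rolle gives one root fewer, but only new roots. The endpoints are roots at both orders, hence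
not among the new ones, and add two to the count. -/
theorem card_roots_iterate_derivative_rodrigues {n : ℕ} :
    ∀ {j : ℕ}, j < n → j + 2 ≤ (derivative^[j] (rodrigues n)).roots.toFinset.card := by
  have key : ∀ j, j < n → ({0, 1} : Finset ℝ) ⊆ (derivative^[j] (rodrigues n)).roots.toFinset := by
    intro j hj x hx
    rw [Multiset.mem_toFinset, mem_roots (iterate_derivative_rodrigues_ne_zero hj.le)]
    simp only [Finset.mem_insert, Finset.mem_singleton] at hx
    rcases hx with rfl | rfl
    · exact eval_zero_iterate_derivative_rodrigues hj
    · exact eval_one_iterate_derivative_rodrigues hj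
  have two : ({0, 1} : Finset ℝ).card = 2 := by simp
  intro j
  induction j with
  | zero =>
    intro hj
    simpa [two] using Finset.card_le_card (key 0 hj)
  | succ j ih =>
    intro hj
    have h1 := ih (by omega)
    have h2 := card_roots_toFinset_le_card_roots_derivative_sdiff_roots_succ
      (derivative^[j] (rodrigues n))
    rw [← Function.iterate_succ_apply' (f := derivative), Nat.succ_eq_add_one] at h2
    have h3 : (derivative^[j + 1] (rodrigues n)).roots.toFinset \
        (derivative^[j] (rodrigues n)).roots.toFinset ∪ {0, 1} ⊆
        (derivative^[j + 1] (rodrigues n)).roots.toFinset :=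
      Finset.union_subset Finset.sdiff_subset (key _ hj)
    have h4 := Finset.card_le_card h3
    rw [Finset.card_union_of_disjoint, two] at h4
    · omega
    · exact Finset.disjoint_of_subset_right (key j (by omega)) Finset.sdiff_disjoint

theorem card_nodes (k : ℕ) : (nodes k).card = k := by
  apply le_antisymm
  · refine (Multiset.toFinset_card_le _).trans ((card_roots' _).trans_eq (natDegree_legendre k))
  · cases k with
    | zero => simp
    | succ k =>
      -- One last use of Rolle: `k + 2` roots at order `k` leave `k + 1` at order `k + 1`, where the
      -- endpoints are no longer counted.
      have h1 := card_roots_iterate_derivative_rodrigues (Nat.lt_add_one k)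
      have h2 := card_roots_toFinset_le_derivative (derivative^[k] (rodrigues (k + 1)))
      rw [← Function.iterate_succ_apply' (f := derivative)] at h2
      have h3 : (derivative^[k + 1] (rodrigues (k + 1))).roots = (legendre (k + 1)).roots := by
        rw [← roots_C_mul _ (legendre_factor_ne_zero (k + 1)), ← factorial_mul_legendre,
          roots_C_mul _ (by positivity)]
      rw [h3] at h2
      rw [nodes]
      omega

theorem eval_legendre_of_mem_nodes {k : ℕ} {c : ℝ} (hc : c ∈ nodes k) :
    (legendre k).eval c = 0 := by
  rw [nodes, Multiset.mem_toFinset, mem_roots (legendre_ne_zero k)] at hc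
  exact hc

theorem mem_Icc_of_mem_nodes {k : ℕ} {c : ℝ} (hc : c ∈ nodes k) : c ∈ Set.Icc (0 : ℝ) 1 :=
  mem_Icc_of_isRoot_legendre (eval_legendre_of_mem_nodes hc)

theorem quad_eval_of_degree_lt_card {k : ℕ} {r : ℝ[X]} (hr : r.degree < k) :
    quad k (fun c => r.eval c) = unitIntegral r := by
  have h := Lagrange.eq_interpolate_of_eval_eq (s := nodes k) (v := fun x : ℝ => x) (f := r)
    (fun x => r.eval x) (fun _ _ _ _ h => h) (by rwa [card_nodes]) (fun _ _ => rfl)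
  conv_rhs => rw [h]
  rw [Lagrange.interpolate_apply, unitIntegral_sum, quad]
  refine Finset.sum_congr rfl fun c _ => ?_
  rw [unitIntegral_C_mul, weight, unitIntegral, smul_eq_mul, mul_comm]

/-- The `k`-point Gauss-Legendre rule is exact in degree less than `2k`. -/
theorem quad_eval {k : ℕ} {p : ℝ[X]} (hp : p.degree < (2 * k : ℕ)) :
    quad k (fun c => p.eval c) = unitIntegral p := by
  -- Divide by `P_k`: its multiple vanishes at the nodes, and integrates to zero because the
  -- quotient has degree below `k`.
  have hdm : legendre k * (p / legendre k) + p % legendre k = p :=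
    EuclideanDomain.div_add_mod p (legendre k)
  have hr : (p % legendre k).degree < k := by
    rw [← degree_legendre k]
    exact EuclideanDomain.mod_lt p (legendre_ne_zero k)
  have hq : (p / legendre k).degree < k := by
    by_cases h0 : p / legendre k = 0
    · simp [h0]
    have hle : (legendre k).degree ≤ p.degree := by
      by_contra! hlt
      exact h0 ((Polynomial.div_eq_zero_iff (legendre_ne_zero k)).mpr hlt)
    have := degree_add_div (legendre_ne_zero k) hle
    have hp0 : p ≠ 0 := by rintro rfl; simp at h0
    rw [degree_legendre, degree_eq_natDegree h0, degree_eq_natDegree hp0] at this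
    rw [degree_eq_natDegree hp0] at hp
    rw [degree_eq_natDegree h0]
    norm_cast at *
    omega
  calc quad k (fun c => p.eval c) = quad k (fun c => (p % legendre k).eval c) := by
        refine Finset.sum_congr rfl fun c hc => ?_
        conv_lhs => rw [← hdm]
        simp [eval_legendre_of_mem_nodes hc]
    _ = unitIntegral (p % legendre k) := quad_eval_of_degree_lt_card hr
    _ = unitIntegral p := by
        conv_rhs => rw [← hdm, unitIntegral_add, unitIntegral_legendre_mul hq, zero_add]

/-! ### Linearity and size of the quadrature -/

section Quad

variable {E : Type*} [NormedAddCommGroup E] [NormedSpace ℝ E] {k : ℕ}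

theorem quad_sub (f g : ℝ → E) : quad k (fun c => f c - g c) = quad k f - quad k g := by
  simp [quad, smul_sub]

theorem quad_smul (a : ℝ) (f : ℝ → E) : quad k (fun c => a • f c) = a • quad k f := by
  simp only [quad, Finset.smul_sum, smul_comm a]

theorem quad_smul_const (f : ℝ → ℝ) (e : E) : quad k (fun c => f c • e) = quad k f • e := by
  simp [quad, Finset.sum_smul, smul_smul]

theorem quad_sum {ι : Type*} (t : Finset ι) (f : ι → ℝ → E) :
    quad k (fun c => ∑ i ∈ t, f i c) = ∑ i ∈ t, quad k (f i) := by
  simp only [quad, Finset.smul_sum]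
  exact Finset.sum_comm

theorem map_quad {V W 𝓕 : Type*} [AddCommGroup V] [Module ℝ V] [AddCommGroup W] [Module ℝ W]
    [FunLike 𝓕 V W] [LinearMapClass 𝓕 ℝ V W] (L : 𝓕) (f : ℝ → V) :
    L (quad k f) = quad k (fun c => L (f c)) := by
  simp [quad, map_sum]

theorem quad_congr {V : Type*} [AddCommGroup V] [Module ℝ V] {f g : ℝ → V}
    (h : ∀ c ∈ Set.Icc (0 : ℝ) 1, f c = g c) : quad k f = quad k g :=
  Finset.sum_congr rfl fun c hc => by rw [h c (mem_Icc_of_mem_nodes hc)]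

/-- The norm of the functional `f ↦ quad k (q • f)`. -/
def quadNorm (k : ℕ) (q : ℝ[X]) : ℝ := ∑ c ∈ nodes k, |weight k c| * |q.eval c|

theorem quadNorm_nonneg (k : ℕ) (q : ℝ[X]) : 0 ≤ quadNorm k q :=
  Finset.sum_nonneg fun _ _ => by positivity

theorem norm_quad_smul_le {f : ℝ → E} {A : ℝ} (q : ℝ[X]) (hA : ∀ c ∈ nodes k, ‖f c‖ ≤ A) :
    ‖quad k (fun c => q.eval c • f c)‖ ≤ quadNorm k q * A := by
  rw [quad, quadNorm, Finset.sum_mul]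
  refine norm_sum_le_of_le _ fun c hc => ?_
  rw [norm_smul, norm_smul, Real.norm_eq_abs, Real.norm_eq_abs, mul_assoc]
  gcongr
  exact hA c hc

theorem norm_quad_le {f : ℝ → E} {A : ℝ} (hA : ∀ c ∈ nodes k, ‖f c‖ ≤ A) :
    ‖quad k f‖ ≤ quadNorm k 1 * A := by
  simpa using norm_quad_smul_le (k := k) 1 hA

theorem quad_legendre_mul_eq_zero {i : ℕ} {q : ℝ[X]} (hi : i ≤ k) (hq : q.degree < i) :
    quad k (fun c => (legendre i * q).eval c) = 0 := by
  rw [quad_eval, unitIntegral_legendre_mul hq]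
  by_cases h0 : q = 0
  · rw [h0, mul_zero, degree_zero]
    exact WithBot.bot_lt_coe _
  · rw [degree_mul, degree_legendre, degree_eq_natDegree h0] at *
    norm_cast at *
    omega

theorem quad_legendre_mul_legendre {i j : ℕ} (hij : i + j < 2 * k) :
    quad k (fun c => (legendre i).eval c * (legendre j).eval c) = if i = j then 1 else 0 := by
  rw [← unitIntegral_legendre_mul_legendre, ← quad_eval (k := k)]
  · simp
  · rw [degree_mul, degree_legendre, degree_legendre]
    exact_mod_cast hij

end Quad

/-! ### Taylor expansions -/

section Taylor

variable {E : Type*} [NormedAddCommGroup E] [NormedSpace ℝ E]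

theorem exists_norm_sub_sum_pow_smul_le {f : ℝ → E} {n : ℕ} (hf : ContDiff ℝ n f) {A : ℝ}
    (hA : ∀ c ∈ Set.Icc (0 : ℝ) 1, ‖iteratedDeriv n f c‖ ≤ A) :
    ∃ a : ℕ → E, ∀ c ∈ Set.Icc (0 : ℝ) 1, ‖f c - ∑ l ∈ Finset.range n, c ^ l • a l‖ ≤ A := by
  have hA0 : 0 ≤ A := (norm_nonneg _).trans (hA 0 (by simp))
  cases n with
  | zero => exact ⟨0, fun c hc => by simpa using hA c hc⟩
  | succ n =>
    refine ⟨fun l => ((l.factorial : ℝ)⁻¹) • iteratedDerivWithin l f (Set.Icc 0 1) 0,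
      fun c hc => ?_⟩
    have h := taylor_mean_remainder_bound (f := f) (n := n) (zero_le_one' ℝ)
      (by exact_mod_cast hf.contDiffOn) hc (C := A) (fun y hy => by
        rw [iteratedDerivWithin_eq_iteratedDeriv (uniqueDiffOn_Icc zero_lt_one) hf.contDiffAt hy]
        exact hA y hy)
    rw [taylor_within_apply] at h
    simp only [sub_zero] at h
    have e : ∀ l, ((l.factorial : ℝ)⁻¹ * c ^ l) • iteratedDerivWithin l f (Set.Icc 0 1) 0 =
        c ^ l • ((l.factorial : ℝ)⁻¹) • iteratedDerivWithin l f (Set.Icc 0 1) 0 := fun l => by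
      rw [smul_smul, mul_comm]
    simp only [e] at h
    refine h.trans ?_
    have h1 : c ^ (n + 1) ≤ 1 := pow_le_one₀ hc.1 hc.2
    have h2 : (1 : ℝ) ≤ n.factorial := by exact_mod_cast n.factorial_pos
    -- The factor `c ^ (n + 1) / n!` of the Taylor remainder is at most `1` on `[0,1]`.
    rw [div_le_iff₀ (by positivity)]
    exact mul_le_mul_of_nonneg_left (h1.trans h2) hA0

/-- The functional annihilates the Taylor polynomial of `f`, so only the remainder contributes. -/
theorem norm_quad_smul_le_of_iteratedDeriv_le {k n : ℕ} {q : ℝ[X]}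
    (hq : ∀ l < n, quad k (fun c => (q * X ^ l).eval c) = 0) {f : ℝ → E} (hf : ContDiff ℝ n f)
    {A : ℝ} (hA : ∀ c ∈ Set.Icc (0 : ℝ) 1, ‖iteratedDeriv n f c‖ ≤ A) :
    ‖quad k (fun c => q.eval c • f c)‖ ≤ quadNorm k q * A := by
  obtain ⟨a, ha⟩ := exists_norm_sub_sum_pow_smul_le hf hA
  have h0 : quad k (fun c => q.eval c • ∑ l ∈ Finset.range n, c ^ l • a l) = 0 := by
    simp only [Finset.smul_sum, quad_sum, smul_smul, quad_smul_const]
    refine Finset.sum_eq_zero fun l hl => ?_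
    have := hq l (Finset.mem_range.mp hl)
    simp only [eval_mul, eval_pow, eval_X] at this
    rw [this, zero_smul]
  have h1 := norm_quad_smul_le (k := k) q fun c hc => ha c (mem_Icc_of_mem_nodes hc)
  simp only [smul_sub, quad_sub, h0, sub_zero] at h1
  exact h1

/-- The error of the `k`-point Gauss-Legendre rule is controlled by the derivative of order
`2k`. -/
theorem abs_integral_sub_quad_le {k : ℕ} {f : ℝ → ℝ} (hf : ContDiff ℝ (2 * k : ℕ) f)
    {A : ℝ} (hA : ∀ c ∈ Set.Icc (0 : ℝ) 1, ‖iteratedDeriv (2 * k) f c‖ ≤ A) :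
    |(∫ c in (0 : ℝ)..1, f c) - quad k f| ≤ (1 + quadNorm k 1) * A := by
  obtain ⟨a, ha⟩ := exists_norm_sub_sum_pow_smul_le hf hA
  -- The rule is exact on the Taylor polynomial `T`. The remainder contributes at most `A` to the
  -- integral and `quadNorm k 1 * A` to the quadrature.
  set T : ℝ[X] := ∑ l ∈ Finset.range (2 * k), C (a l) * X ^ l with hT
  have hTe : ∀ c, T.eval c = ∑ l ∈ Finset.range (2 * k), c ^ l • a l := fun c => by
    rw [hT, eval_finsetSum]
    exact Finset.sum_congr rfl fun l _ => by
      rw [eval_C_mul, eval_pow, eval_X, smul_eq_mul, mul_comm]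
  have hTd : T.degree < (2 * k : ℕ) := by
    refine (degree_sum_le _ _).trans_lt ((Finset.sup_lt_iff (WithBot.bot_lt_coe _)).mpr ?_)
    intro l hl
    refine (degree_C_mul_X_pow_le _ _).trans_lt ?_
    exact_mod_cast Finset.mem_range.mp hl
  simp only [← hTe] at ha
  have h1 := norm_quad_le (k := k) fun c hc => ha c (mem_Icc_of_mem_nodes hc)
  have h2 : ‖∫ c in (0 : ℝ)..1, (f c - T.eval c)‖ ≤ A * |1 - 0| :=
    norm_integral_le_of_norm_le_const fun c hc => ha c <| by
      rw [Set.uIoc_of_le zero_le_one] at hc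
      exact ⟨hc.1.le, hc.2⟩
  rw [quad_sub, quad_eval hTd, Real.norm_eq_abs] at h1
  rw [integral_sub (hf.continuous.intervalIntegrable _ _) (intervalIntegrable_eval T _ _),
    Real.norm_eq_abs, sub_zero, abs_one, mul_one] at h2
  change |_ - unitIntegral T| ≤ A at h2
  have h3 := abs_sub ((∫ c in (0 : ℝ)..1, f c) - unitIntegral T) (quad k f - unitIntegral T)
  rw [sub_sub_sub_cancel_right] at h3
  linarith

end Taylor

/-! ### Derivative bounds along slowly varying curves -/

section Bounds

variable {E F : Type*} [NormedAddCommGroup E] [NormedSpace ℝ E]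
  [NormedAddCommGroup F] [NormedSpace ℝ F]

/-- On `[0,1]`, the curve `σ` stays in the ball of radius `R` and its derivatives of order
`i = 1, …, N` are bounded by `(D h) ^ i`. -/
structure SlowCurve (N : ℕ) (D R h : ℝ) (σ : ℝ → E) : Prop where
  contDiff : ContDiff ℝ ∞ σ
  norm_le : ∀ c ∈ Set.Icc (0 : ℝ) 1, ‖σ c‖ ≤ R
  norm_iteratedDeriv_le : ∀ i, 1 ≤ i → i ≤ N → ∀ c ∈ Set.Icc (0 : ℝ) 1,
    ‖iteratedDeriv i σ c‖ ≤ (D * h) ^ i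

theorem exists_norm_iteratedFDeriv_le [ProperSpace E] {f : E → F} (hf : ContDiff ℝ ∞ f) (R : ℝ)
    (N : ℕ) : ∃ M, 0 ≤ M ∧ ∀ i ≤ N, ∀ y, ‖y‖ ≤ R → ‖iteratedFDeriv ℝ i f y‖ ≤ M := by
  have h : ∀ i, ∃ M, ∀ y ∈ Metric.closedBall (0 : E) R, ‖iteratedFDeriv ℝ i f y‖ ≤ M := fun i =>
    (isCompact_closedBall (0 : E) R).exists_bound_of_continuousOn
      (hf.continuous_iteratedFDeriv (m := i) (by exact_mod_cast le_top)).continuousOn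
  choose M hM using h
  refine ⟨∑ i ∈ Finset.range (N + 1), |M i|, by positivity, fun i hi y hy => ?_⟩
  refine (hM i y (by simpa using hy)).trans ((le_abs_self _).trans ?_)
  exact Finset.single_le_sum (f := fun i => |M i|) (fun _ _ => abs_nonneg _)
    (Finset.mem_range.mpr (by omega))

/-- Faà di Bruno: the geometric bounds `(D h) ^ i` on a slow curve are what composition with a
smooth map preserves, up to `i!` and a bound for the outer derivatives on the ball. -/
theorem exists_norm_iteratedDeriv_comp_le [ProperSpace E] {f : E → F} (hf : ContDiff ℝ ∞ f)
    (N : ℕ) {D : ℝ} (hD : 1 ≤ D) (R : ℝ) : ∃ M, 0 ≤ M ∧ ∀ (h : ℝ) (σ : ℝ → E), 0 ≤ h →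
      SlowCurve N D R h σ → ∀ i ≤ N, ∀ c ∈ Set.Icc (0 : ℝ) 1,
        ‖iteratedDeriv i (fun c => f (σ c)) c‖ ≤ M * h ^ i := by
  obtain ⟨M, hM0, hM⟩ := exists_norm_iteratedFDeriv_le hf R N
  refine ⟨N.factorial * M * D ^ N, by positivity, fun h σ hh hσ i hi c hc => ?_⟩
  have h1 := norm_iteratedFDeriv_comp_le (n := i) hf hσ.contDiff (by exact_mod_cast le_top) c
    (C := M) (D := D * h) (fun l hl => hM l (hl.trans hi) _ (hσ.norm_le c hc))
    (fun l hl1 hl => by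
      rw [norm_iteratedFDeriv_eq_norm_iteratedDeriv]
      exact hσ.norm_iteratedDeriv_le l hl1 (hl.trans hi) c hc)
  rw [norm_iteratedFDeriv_eq_norm_iteratedDeriv] at h1
  refine h1.trans ?_
  rw [mul_pow, ← mul_assoc]
  have h2 : (i.factorial : ℝ) ≤ N.factorial := by exact_mod_cast Nat.factorial_le hi
  have h3 : D ^ i ≤ D ^ N := pow_le_pow_right₀ hD hi
  gcongr

theorem exists_norm_quad_smul_comp_le [ProperSpace E] {f : E → F} (hf : ContDiff ℝ ∞ f)
    (k N : ℕ) (q : ℝ[X]) {D : ℝ} (hD : 1 ≤ D) (R : ℝ) : ∃ M, 0 ≤ M ∧ ∀ (h : ℝ) (σ : ℝ → E),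
      0 ≤ h → SlowCurve N D R h σ → ∀ n ≤ N,
        (∀ l < n, quad k (fun c => (q * X ^ l).eval c) = 0) →
          ‖quad k (fun c => q.eval c • f (σ c))‖ ≤ M * h ^ n := by
  obtain ⟨M, hM0, hM⟩ := exists_norm_iteratedDeriv_comp_le hf N hD R
  refine ⟨quadNorm k q * M, mul_nonneg (quadNorm_nonneg _ _) hM0, fun h σ hh hσ n hn hq => ?_⟩
  rw [mul_assoc]
  exact norm_quad_smul_le_of_iteratedDeriv_le hq
    ((hf.comp hσ.contDiff).of_le (by exact_mod_cast le_top)) (hM h σ hh hσ n hn)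

end Bounds

/-! ### The line-integral collocation equation -/

section Stage

variable {E F : Type*} [NormedAddCommGroup E] [NormedSpace ℝ E]
  [NormedAddCommGroup F] [NormedSpace ℝ F]

/-- The discrete Fourier coefficient of order `i` of `f`. -/
def coeff (k : ℕ) (f : ℝ → F) (i : ℕ) : F := quad k fun c => (legendre i).eval c • f c

/-- The discrete Fourier coefficient of order `(i, j)` of `f`. -/
def coeff₂ (k : ℕ) (f : ℝ → F) (i j : ℕ) : F :=
  quad k fun c => ((legendre i).eval c * (legendre j).eval c) • f c

/-- The Fourier coefficients of the derivative of the numerical solution. -/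
def stageCoeff (k s : ℕ) (A : E → E →L[ℝ] E) (G : E → E) (T : E →L[ℝ] E) (σ : ℝ → E) (α : ℝ)
    (i : ℕ) : E :=
  (∑ j ∈ Finset.range s, coeff₂ k (fun c => A (σ c)) i j (coeff k (fun c => G (σ c)) j)) -
    if i = 0 then α • T (coeff k (fun c => G (σ c)) 0) else 0

/-- Orthogonality of `P_i` to lower degrees would give order `i`; only `N` derivatives are under
control, hence the minimum. -/
theorem exists_norm_coeff_le [ProperSpace E] {f : E → F} (hf : ContDiff ℝ ∞ f)
    (k N i : ℕ) (hi : i ≤ k) {D : ℝ} (hD : 1 ≤ D) (R : ℝ) : ∃ M, 0 ≤ M ∧ ∀ (h : ℝ) (σ : ℝ → E),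
      0 ≤ h → SlowCurve N D R h σ → ‖coeff k (fun c => f (σ c)) i‖ ≤ M * h ^ min i N := by
  obtain ⟨M, hM0, hM⟩ := exists_norm_quad_smul_comp_le hf k N (legendre i) hD R
  refine ⟨M, hM0, fun h σ hh hσ => hM h σ hh hσ _ (min_le_right _ _) fun l hl => ?_⟩
  refine quad_legendre_mul_eq_zero hi ?_
  rw [degree_X_pow]
  exact_mod_cast hl.trans_le (min_le_left _ _)

/-- `P_i P_j` annihilates degrees below `i - j`. The truncated subtraction leaves plain boundedness
when `j ≥ N`. -/
theorem exists_norm_coeff₂_le [ProperSpace E] {f : E → F} (hf : ContDiff ℝ ∞ f)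
    (k N i j : ℕ) (hi : i ≤ k) (hN : N ≤ i) {D : ℝ} (hD : 1 ≤ D) (R : ℝ) :
    ∃ M, 0 ≤ M ∧ ∀ (h : ℝ) (σ : ℝ → E),
      0 ≤ h → SlowCurve N D R h σ → ‖coeff₂ k (fun c => f (σ c)) i j‖ ≤ M * h ^ (N - j) := by
  obtain ⟨M, hM0, hM⟩ := exists_norm_quad_smul_comp_le hf k N (legendre i * legendre j) hD R
  refine ⟨M, hM0, fun h σ hh hσ => ?_⟩
  have := hM h σ hh hσ (N - j) (Nat.sub_le _ _) fun l hl => ?_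
  · simpa only [eval_mul, coeff₂] using this
  · rw [mul_assoc]
    refine quad_legendre_mul_eq_zero hi ?_
    rw [degree_mul, degree_legendre, degree_X_pow]
    exact_mod_cast (by omega : j + l < i)

/-- The orders `N - j` of the matrix coefficient and `min j N` of the gradient coefficient add up to
`N` for every `j`. The `α` term occurs only for `i = 0`, which forces `N = 0`, so boundedness of `α`
is enough. -/
theorem exists_norm_stageCoeff_le [ProperSpace E] {k s : ℕ} (hsk : s ≤ k) {A : E → E →L[ℝ] E}
    (hA : ContDiff ℝ ∞ A) {G : E → E} (hG : ContDiff ℝ ∞ G) (T : E →L[ℝ] E)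
    (N i : ℕ) (hi : i < s) (hN : N ≤ i) {D : ℝ} (hD : 1 ≤ D) (R K : ℝ) :
    ∃ M, 0 ≤ M ∧ ∀ (h α : ℝ) (σ : ℝ → E), 0 ≤ h → h ≤ 1 → |α| ≤ K → SlowCurve N D R h σ →
      ‖stageCoeff k s A G T σ α i‖ ≤ M * h ^ N := by
  have h1 : ∀ j, ∃ M, 0 ≤ M ∧ ∀ (h : ℝ) (σ : ℝ → E), 0 ≤ h → SlowCurve N D R h σ → j < s →
      ‖coeff k (fun c => G (σ c)) j‖ ≤ M * h ^ min j N := fun j => by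
    by_cases hj : j < s
    · obtain ⟨M, hM0, hM⟩ := exists_norm_coeff_le hG k N j (by omega) hD R
      exact ⟨M, hM0, fun h σ hh hσ _ => hM h σ hh hσ⟩
    · exact ⟨0, le_rfl, fun _ _ _ _ h => absurd h hj⟩
  choose a ha0 ha using h1
  choose b hb0 hb using fun j => exists_norm_coeff₂_le hA k N i j (by omega) hN hD R
  have hab : 0 ≤ ∑ j ∈ Finset.range s, b j * a j :=
    Finset.sum_nonneg fun j _ => mul_nonneg (hb0 j) (ha0 j)
  refine ⟨∑ j ∈ Finset.range s, b j * a j + |K| * (‖T‖ * a 0),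
    add_nonneg hab (mul_nonneg (abs_nonneg _) (mul_nonneg (norm_nonneg _) (ha0 0))),
    fun h α σ hh hh1 hα hσ => ?_⟩
  rw [stageCoeff, add_mul, Finset.sum_mul]
  refine (norm_sub_le _ _).trans (add_le_add (norm_sum_le_of_le _ fun j hj => ?_) ?_)
  · have e1 := hb j h σ hh hσ
    have e2 := ha j h σ hh hσ (Finset.mem_range.mp hj)
    calc _ ≤ (b j * h ^ (N - j)) * (a j * h ^ min j N) :=
          (ContinuousLinearMap.le_opNorm _ _).trans
            (mul_le_mul e1 e2 (norm_nonneg _) ((norm_nonneg _).trans e1))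
      _ = b j * a j * h ^ N := by
          rw [mul_mul_mul_comm, ← pow_add]
          congr 2
          omega
  · split_ifs with h0
    · obtain rfl : N = 0 := by omega
      have e2 := ha 0 h σ hh hσ (by omega)
      simp only [pow_zero, mul_one, min_self] at e2 ⊢
      rw [norm_smul, Real.norm_eq_abs]
      have e3 := ContinuousLinearMap.le_opNorm T (coeff k (fun c => G (σ c)) 0)
      have e4 := hα.trans (le_abs_self K)
      gcongr
      exact e3.trans (by gcongr)
    · simpa using mul_nonneg (mul_nonneg (abs_nonneg K) (mul_nonneg (norm_nonneg T) (ha0 0)))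
        (pow_nonneg hh N)

/-- `σ` solves `σ' = h ∑ P_i v_i`. -/
def IsExpansion (s : ℕ) (v : ℕ → E) (h : ℝ) (σ : ℝ → E) : Prop :=
  ∀ c, HasDerivAt σ (h • ∑ i ∈ Finset.range s, (legendre i).eval c • v i) c

theorem iteratedDeriv_sum_eval_smul (s : ℕ) (p : ℕ → ℝ[X]) (v : ℕ → E) (h : ℝ) (n : ℕ) :
    iteratedDeriv n (fun c => h • ∑ i ∈ Finset.range s, (p i).eval c • v i) =
      fun c => h • ∑ i ∈ Finset.range s, (derivative^[n] (p i)).eval c • v i := by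
  induction n with
  | zero => simp
  | succ n ih =>
    rw [iteratedDeriv_succ, ih]
    funext c
    refine HasDerivAt.deriv ?_
    refine (HasDerivAt.fun_sum fun i _ => ?_).const_smul h
    rw [Function.iterate_succ_apply']
    exact (Polynomial.hasDerivAt _ c).smul_const (v i)

theorem contDiff_sum_eval_smul (s : ℕ) (p : ℕ → ℝ[X]) (v : ℕ → E) (h : ℝ) :
    ContDiff ℝ ∞ (fun c => h • ∑ i ∈ Finset.range s, (p i).eval c • v i) :=
  (ContDiff.sum fun i _ => ContDiff.smul
    (by simpa only [coe_aeval_eq_eval] using (p i).contDiff_aeval (𝕜 := ℝ) ∞)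
    contDiff_const).const_smul h

theorem IsExpansion.deriv_eq {s : ℕ} {v : ℕ → E} {h : ℝ} {σ : ℝ → E} (hσ : IsExpansion s v h σ) :
    deriv σ = fun c => h • ∑ i ∈ Finset.range s, (legendre i).eval c • v i :=
  funext fun c => (hσ c).deriv

theorem IsExpansion.contDiff {s : ℕ} {v : ℕ → E} {h : ℝ} {σ : ℝ → E}
    (hσ : IsExpansion s v h σ) : ContDiff ℝ ∞ σ := by
  rw [contDiff_infty_iff_deriv, hσ.deriv_eq]
  exact ⟨fun c => (hσ c).differentiableAt, contDiff_sum_eval_smul _ _ _ _⟩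

theorem exists_abs_eval_le (p : ℝ[X]) : ∃ M, 0 ≤ M ∧ ∀ c ∈ Set.Icc (0 : ℝ) 1, |p.eval c| ≤ M := by
  obtain ⟨M, hM⟩ := isCompact_Icc.exists_bound_of_continuousOn
    (p.continuous.continuousOn (s := Set.Icc (0 : ℝ) 1))
  exact ⟨M, (norm_nonneg _).trans (hM 0 (by simp)), hM⟩

/-- Bounded numerical solutions vary slowly, uniformly in the step size. -/
theorem exists_slowCurve [ProperSpace E] {k s : ℕ} (hsk : s ≤ k) {A : E → E →L[ℝ] E}
    (hA : ContDiff ℝ ∞ A) {G : E → E} (hG : ContDiff ℝ ∞ G) (T : E →L[ℝ] E) (R K : ℝ) (N : ℕ) :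
    ∃ D, 1 ≤ D ∧ ∀ (h α : ℝ) (σ : ℝ → E), 0 ≤ h → h ≤ 1 → |α| ≤ K →
      (∀ c ∈ Set.Icc (0 : ℝ) 1, ‖σ c‖ ≤ R) →
      IsExpansion s (stageCoeff k s A G T σ α) h σ → SlowCurve N D R h σ := by
  induction N with
  | zero =>
    exact ⟨1, le_rfl, fun h α σ _ _ _ hR hσ => ⟨hσ.contDiff, hR, fun i h1 h2 => by omega⟩⟩
  | succ N ih =>
    obtain ⟨D, hD, ih⟩ := ih
    have h1 : ∀ i, ∃ M, 0 ≤ M ∧ ∀ (h α : ℝ) (σ : ℝ → E), 0 ≤ h → h ≤ 1 → |α| ≤ K →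
        SlowCurve N D R h σ → i < s → N ≤ i → ‖stageCoeff k s A G T σ α i‖ ≤ M * h ^ N := by
      intro i
      by_cases hi : i < s ∧ N ≤ i
      · obtain ⟨M, hM0, hM⟩ := exists_norm_stageCoeff_le hsk hA hG T N i hi.1 hi.2 hD R K
        exact ⟨M, hM0, fun h α σ a b c d _ _ => hM h α σ a b c d⟩
      · exact ⟨0, le_rfl, fun _ _ _ _ _ _ _ a b => absurd ⟨a, b⟩ hi⟩
    choose M hM0 hM using h1
    choose L hL0 hL using fun i => exists_abs_eval_le (derivative^[N] (legendre i))
    set S := ∑ i ∈ Finset.range s, L i * M i with hS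
    refine ⟨max D S, hD.trans (le_max_left _ _), fun h α σ hh hh1 hα hR hσ => ?_⟩
    have hslow := ih h α σ hh hh1 hα hR hσ
    refine ⟨hσ.contDiff, hR, fun i hi1 hi c hc => ?_⟩
    have hD0 : 0 ≤ D * h := by positivity
    rcases Nat.lt_or_ge i (N + 1) with hlt | hge
    · refine (hslow.norm_iteratedDeriv_le i hi1 (by omega) c hc).trans ?_
      gcongr
      exact le_max_left _ _
    · obtain rfl : i = N + 1 := by omega
      rw [iteratedDeriv_succ', hσ.deriv_eq, iteratedDeriv_sum_eval_smul, norm_smul,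
        Real.norm_eq_abs, abs_of_nonneg hh]
      -- The `N`-th derivative kills `P_i` for `i < N`; the remaining coefficients are `O(h^N)` by
      -- the induction hypothesis.
      have h2 : ‖∑ i ∈ Finset.range s,
          (derivative^[N] (legendre i)).eval c • stageCoeff k s A G T σ α i‖ ≤ S * h ^ N := by
        rw [hS, Finset.sum_mul]
        refine norm_sum_le_of_le _ fun i hi => ?_
        rcases Nat.lt_or_ge i N with hlt | hge
        · rw [iterate_derivative_eq_zero (by rwa [natDegree_legendre])]
          simpa using mul_nonneg (mul_nonneg (hL0 i) (hM0 i)) (pow_nonneg hh N)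
        · rw [norm_smul, mul_assoc]
          exact mul_le_mul (hL i c hc) (hM i h α σ hh hh1 hα hslow (Finset.mem_range.mp hi) hge)
            (norm_nonneg _) (hL0 i)
      calc h * _ ≤ h * (S * h ^ N) := by gcongr
        _ = S * h ^ (N + 1) := by ring
        _ ≤ max D S ^ (N + 1) * h ^ (N + 1) := by
            gcongr
            -- A base of at least `1` lets a power of it absorb the constant `S`.
            have h3 : 1 ≤ max D S := hD.trans (le_max_left _ _)
            exact (le_max_right D S).trans (le_self_pow₀ h3 (by omega))
        _ = (max D S * h) ^ (N + 1) := by rw [mul_pow]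

end Stage

/-! ### The error in the Casimir -/

section Casimir

variable {E : Type*} [NormedAddCommGroup E] [InnerProductSpace ℝ E]

theorem contDiff_gradient [CompleteSpace E] {C : E → ℝ} (hC : ContDiff ℝ ∞ C) : ContDiff ℝ ∞ (gradient C) := by
  have h : ContDiff ℝ ∞ (fderiv ℝ C) := hC.fderiv_right (by simp)
  exact (InnerProductSpace.toDual ℝ E).symm.toContinuousLinearEquiv.contDiff.comp h

theorem deriv_comp_eq_inner [CompleteSpace E] {C : E → ℝ} (hC : ContDiff ℝ ∞ C) {s : ℕ} {v : ℕ → E} {h : ℝ}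
    {σ : ℝ → E} (hσ : IsExpansion s v h σ) (c : ℝ) :
    deriv (fun c => C (σ c)) c =
      h * ∑ i ∈ Finset.range s, inner ℝ ((legendre i).eval c • gradient C (σ c)) (v i) := by
  have h1 := ((hC.differentiable (by simp)) (σ c)).hasFDerivAt.comp_hasDerivAt c (hσ c)
  rw [show (fun c => C (σ c)) = C ∘ σ from rfl, h1.deriv, ← inner_gradient_left, inner_smul_right,
    inner_sum]
  simp only [inner_smul_left, inner_smul_right, conj_trivial]

theorem quad_deriv_comp [CompleteSpace E] {C : E → ℝ} (hC : ContDiff ℝ ∞ C) (k : ℕ) {s : ℕ} {v : ℕ → E} {h : ℝ}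
    {σ : ℝ → E} (hσ : IsExpansion s v h σ) :
    quad k (deriv fun c => C (σ c)) =
      h * ∑ i ∈ Finset.range s, inner ℝ (coeff k (fun c => gradient C (σ c)) i) (v i) := by
  have h1 : (deriv fun c => C (σ c)) = fun c => h •
      ∑ i ∈ Finset.range s, inner ℝ ((legendre i).eval c • gradient C (σ c)) (v i) :=
    funext (deriv_comp_eq_inner hC hσ)
  rw [h1, quad_smul, quad_sum, smul_eq_mul]
  congr 1
  refine Finset.sum_congr rfl fun i _ => ?_
  simp only [coeff, real_inner_comm (v i)]
  exact (map_quad (innerSL ℝ (v i)) _).symm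

theorem integral_deriv_comp {C : E → ℝ} (hC : ContDiff ℝ ∞ C) {s : ℕ} {v : ℕ → E} {h : ℝ}
    {σ : ℝ → E} (hσ : IsExpansion s v h σ) :
    ∫ c in (0 : ℝ)..1, deriv (fun c => C (σ c)) c = C (σ 1) - C (σ 0) := by
  have h1 : ContDiff ℝ ∞ (fun c => C (σ c)) := hC.comp hσ.contDiff
  exact intervalIntegral.integral_deriv_eq_sub
    (fun c _ => h1.differentiable (by simp) c)
    ((h1.continuous_deriv (by simp)).intervalIntegrable _ _)

/-- The increment of `C` is the integral of `(C ∘ σ)'`, whose quadrature is zero by `horth`; what is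
left is the quadrature error. -/
theorem abs_sub_le_of_sum_inner_eq_zero [CompleteSpace E] {C : E → ℝ} (hC : ContDiff ℝ ∞ C) (k : ℕ) {s : ℕ}
    {v : ℕ → E} {h : ℝ} {σ : ℝ → E} (hσ : IsExpansion s v h σ)
    (horth : ∑ i ∈ Finset.range s, inner ℝ (coeff k (fun c => gradient C (σ c)) i) (v i) = 0)
    {M : ℝ} (hM : ∀ c ∈ Set.Icc (0 : ℝ) 1,
      ‖iteratedDeriv (2 * k + 1) (fun c => C (σ c)) c‖ ≤ M * h ^ (2 * k + 1)) :
    |C (σ 1) - C (σ 0)| ≤ (1 + quadNorm k 1) * M * h ^ (2 * k + 1) := by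
  have h1 : ContDiff ℝ ∞ (fun c => C (σ c)) := hC.comp hσ.contDiff
  have h2 := abs_integral_sub_quad_le (k := k) (f := deriv fun c => C (σ c))
    (((contDiff_infty_iff_deriv.mp h1).2).of_le (by
      generalize 2 * k = n
      exact_mod_cast le_top))
    (A := M * h ^ (2 * k + 1)) (fun c hc => by
      rw [← iteratedDeriv_succ']
      exact hM c hc)
  rw [quad_deriv_comp hC k hσ, horth, mul_zero, sub_zero, integral_deriv_comp hC hσ] at h2
  rwa [mul_assoc]

end Casimir

/-! ### Discrete Legendre projections -/

section Projection

variable {E : Type*} [NormedAddCommGroup E] [NormedSpace ℝ E]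

/-- The discrete orthogonal projection of `f` to the polynomials of degree less than `s`. -/
def proj (k s : ℕ) (f : ℝ → E) (c : ℝ) : E :=
  ∑ i ∈ Finset.range s, (legendre i).eval c • coeff k f i

/-- Subtracting a multiple of the top Legendre polynomial cancels the leading coefficient. -/
theorem exists_eq_sum_legendre {s : ℕ} : ∀ {q : ℝ[X]}, q.degree < s →
    ∃ a : ℕ → ℝ, q = ∑ i ∈ Finset.range s, C (a i) * legendre i := by
  induction s with
  | zero =>
    intro q hq
    refine ⟨0, ?_⟩
    have : q = 0 := by
      rw [← degree_eq_bot]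
      exact Nat.WithBot.lt_zero_iff.mp (by simpa using hq)
    simp [this]
  | succ s ih =>
    intro q hq
    have hlead : (legendre s).coeff s ≠ 0 := by
      have := leadingCoeff_ne_zero.mpr (legendre_ne_zero s)
      rwa [leadingCoeff, natDegree_legendre] at this
    obtain ⟨a, ha⟩ := ih (q := q - C (q.coeff s / (legendre s).coeff s) * legendre s) (by
      rw [degree_lt_iff_coeff_zero] at hq ⊢
      intro m hm
      rcases hm.eq_or_lt with rfl | hlt
      · rw [coeff_sub, coeff_C_mul, div_mul_cancel₀ _ hlead, sub_self]
      · rw [coeff_sub, coeff_C_mul, hq m hlt, coeff_eq_zero_of_natDegree_lt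
          (show (legendre s).natDegree < m by rwa [natDegree_legendre])]
        simp)
    refine ⟨Function.update a s (q.coeff s / (legendre s).coeff s), ?_⟩
    rw [Finset.sum_range_succ, Function.update_self, ← sub_eq_iff_eq_add, ha]
    refine Finset.sum_congr rfl fun i hi => ?_
    rw [Function.update_of_ne (Finset.mem_range.mp hi).ne]

theorem quad_legendre_mul_sum {k s j : ℕ} (hsk : s ≤ k) (hj : j < s) (a : ℕ → E) :
    quad k (fun c => (legendre j).eval c •
      ∑ i ∈ Finset.range s, (legendre i).eval c • a i) = a j := by
  simp only [Finset.smul_sum, smul_smul, quad_sum, quad_smul_const]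
  rw [Finset.sum_eq_single j]
  · rw [quad_legendre_mul_legendre (by omega), if_pos rfl, one_smul]
  · intro i hi hne
    rw [Finset.mem_range] at hi
    rw [quad_legendre_mul_legendre (by omega), if_neg hne.symm, zero_smul]
  · exact fun h => absurd (Finset.mem_range.mpr hj) h

theorem proj_eval_smul {k s : ℕ} (hsk : s ≤ k) {q : ℝ[X]} (hq : q.degree < s) (e : E) (c : ℝ) :
    proj k s (fun c => q.eval c • e) c = q.eval c • e := by
  obtain ⟨a, rfl⟩ := exists_eq_sum_legendre hq
  have h (c : ℝ) : (∑ i ∈ Finset.range s, Polynomial.C (a i) * legendre i).eval c • e =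
      ∑ i ∈ Finset.range s, (legendre i).eval c • (a i • e) := by
    rw [eval_finsetSum, Finset.sum_smul]
    exact Finset.sum_congr rfl fun i _ => by rw [eval_C_mul, smul_smul, mul_comm]
  simp only [h]
  rw [proj]
  refine Finset.sum_congr rfl fun i hi => ?_
  rw [coeff, quad_legendre_mul_sum hsk (Finset.mem_range.mp hi)]

theorem coeff_sub_proj {k s j : ℕ} (hsk : s ≤ k) (hj : j < s) (f : ℝ → E) :
    coeff k (fun c => f c - proj k s f c) j = 0 := by
  simp only [coeff, smul_sub, quad_sub]
  simp only [proj]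
  rw [quad_legendre_mul_sum hsk hj, coeff, sub_self]

theorem proj_sub (k s : ℕ) (f g : ℝ → E) (c : ℝ) :
    proj k s (fun c => f c - g c) c = proj k s f c - proj k s g c := by
  simp [proj, coeff, smul_sub, quad_sub]

theorem proj_sum {ι : Type*} (k s : ℕ) (t : Finset ι) (f : ι → ℝ → E) (c : ℝ) :
    proj k s (fun c => ∑ l ∈ t, f l c) c = ∑ l ∈ t, proj k s (f l) c := by
  simp only [proj, coeff, Finset.smul_sum, quad_sum]
  exact Finset.sum_comm

/-- The projection reproduces the Taylor polynomial of degree below `s`, so the error of `f` is that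
of its Taylor remainder; the constant bounds identity minus projection. -/
theorem exists_norm_sub_proj_le {k s : ℕ} (hsk : s ≤ k) : ∃ M, 0 ≤ M ∧ ∀ {f : ℝ → E},
    ContDiff ℝ s f → ∀ {A : ℝ}, (∀ c ∈ Set.Icc (0 : ℝ) 1, ‖iteratedDeriv s f c‖ ≤ A) →
      ∀ c ∈ Set.Icc (0 : ℝ) 1, ‖f c - proj k s f c‖ ≤ M * A := by
  choose L hL0 hL using fun i => exists_abs_eval_le (legendre i)
  refine ⟨1 + ∑ i ∈ Finset.range s, L i * quadNorm k (legendre i),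
    add_nonneg zero_le_one (Finset.sum_nonneg fun i _ => mul_nonneg (hL0 i) (quadNorm_nonneg _ _)),
    fun {f} hf {A} hA c hc => ?_⟩
  obtain ⟨a, ha⟩ := exists_norm_sub_sum_pow_smul_le hf hA
  have hT : proj k s (fun c => ∑ l ∈ Finset.range s, c ^ l • a l) c =
      ∑ l ∈ Finset.range s, c ^ l • a l := by
    rw [proj_sum]
    refine Finset.sum_congr rfl fun l hl => ?_
    have := proj_eval_smul hsk (q := X ^ l) (by
      rw [degree_X_pow]
      exact_mod_cast Finset.mem_range.mp hl) (a l) c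
    simpa only [eval_pow, eval_X] using this
  set r : ℝ → E := fun c => f c - ∑ l ∈ Finset.range s, c ^ l • a l with hr
  have h1 : f c - proj k s f c = r c - proj k s r c := by
    rw [hr, proj_sub, hT, sub_sub_sub_cancel_right]
  rw [h1, add_mul, one_mul, Finset.sum_mul]
  refine (norm_sub_le _ _).trans (add_le_add (ha c hc) (norm_sum_le_of_le _ fun i _ => ?_))
  rw [norm_smul, mul_assoc]
  exact mul_le_mul (hL i c hc)
    (norm_quad_smul_le _ fun c hc => ha c (mem_Icc_of_mem_nodes hc)) (norm_nonneg _) (hL0 i)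

end Projection

/-! ### The numerator in the definition of `α` -/

section Numerator

variable {E : Type*} [NormedAddCommGroup E] [InnerProductSpace ℝ E]

/-- The numerator in the definition of `α`. -/
def numerator (k s : ℕ) (κ : ℝ → E) (a : ℝ → E →L[ℝ] E) (g : ℝ → E) : ℝ :=
  ∑ i ∈ Finset.range s, ∑ j ∈ Finset.range s,
    inner ℝ (coeff k κ i) (coeff₂ k a i j (coeff k g j))

theorem inner_coeff₂_apply (k : ℕ) (a : ℝ → E →L[ℝ] E) (i j : ℕ) (x y : E) :
    inner ℝ x (coeff₂ k a i j y) =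
      quad k fun c => (legendre i).eval c * (legendre j).eval c * inner ℝ x (a c y) := by
  have h1 := map_quad (k := k) ((innerSL ℝ x) ∘L (ContinuousLinearMap.apply ℝ E y))
    (fun c => ((legendre i).eval c * (legendre j).eval c) • a c)
  simpa [inner_smul_right, coeff₂] using h1

theorem numerator_eq_quad (k s : ℕ) (κ : ℝ → E) (a : ℝ → E →L[ℝ] E) (g : ℝ → E) :
    numerator k s κ a g = quad k fun c => inner ℝ (proj k s κ c) (a c (proj k s g c)) := by
  simp only [proj, map_sum, map_smul, sum_inner, inner_sum, inner_smul_left, inner_smul_right,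
    conj_trivial, Finset.mul_sum, quad_sum, numerator, inner_coeff₂_apply]
  rw [Finset.sum_comm]
  simp only [mul_assoc, mul_left_comm]

/-- The residual has vanishing discrete coefficients below `s`, hence is discretely orthogonal to
the range of the projection. -/
theorem quad_inner_sub_proj_proj {k s : ℕ} (hsk : s ≤ k) (κ w : ℝ → E) :
    quad k (fun c => inner ℝ (κ c - proj k s κ c) (proj k s w c)) = 0 := by
  have h (c : ℝ) : (inner ℝ (κ c - proj k s κ c) (proj k s w c) : ℝ) =
      ∑ i ∈ Finset.range s, inner ℝ (coeff k w i) ((legendre i).eval c • (κ c - proj k s κ c)) := by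
    conv_lhs => rw [proj.eq_1 k s w]
    simp only [inner_sum, inner_smul_right, real_inner_comm]
  simp only [h, quad_sum]
  refine Finset.sum_eq_zero fun i hi => ?_
  have h1 := map_quad (k := k) (innerSL ℝ (coeff k w i))
    (fun c => (legendre i).eval c • (κ c - proj k s κ c))
  have h2 := coeff_sub_proj hsk (Finset.mem_range.mp hi) κ
  rw [coeff] at h2
  rw [h2, map_zero] at h1
  exact h1.symm

/-- If `κᵀ a = 0`, the numerator is quadratic in the projection errors. -/
theorem numerator_eq_quad_sub_proj {k s : ℕ} (hsk : s ≤ k) {κ : ℝ → E} {a : ℝ → E →L[ℝ] E}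
    (g : ℝ → E) (h : ∀ c y, inner ℝ (κ c) (a c y) = (0 : ℝ)) :
    numerator k s κ a g = quad k fun c => inner ℝ (κ c - proj k s κ c)
      (a c (g c - proj k s g c) - (a c (g c) - proj k s (fun c => a c (g c)) c)) := by
  have h0 := quad_inner_sub_proj_proj hsk κ (fun c => a c (g c))
  rw [numerator_eq_quad]
  -- Subtract the vanishing quadrature `h0`; pointwise, what remains on the right is `-⟨κ - pκ,
  -- a(pg)⟩`, which equals `⟨pκ, a(pg)⟩` because `κᵀa = 0`.
  refine Eq.trans ?_ (sub_zero _)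
  rw [← h0, ← quad_sub]
  congr 1
  funext c
  simp only [map_sub, inner_sub_left, inner_sub_right, h]
  ring

theorem exists_abs_numerator_le [ProperSpace E] {k s : ℕ} (hsk : s ≤ k) {κ G : E → E}
    {A : E → E →L[ℝ] E} (hκ : ContDiff ℝ ∞ κ) (hA : ContDiff ℝ ∞ A) (hG : ContDiff ℝ ∞ G)
    (h : ∀ x y, inner ℝ (κ x) (A x y) = (0 : ℝ)) {D : ℝ} (hD : 1 ≤ D) (R : ℝ) :
    ∃ M, 0 ≤ M ∧ ∀ (h : ℝ) (σ : ℝ → E), 0 ≤ h → SlowCurve s D R h σ →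
      |numerator k s (fun c => κ (σ c)) (fun c => A (σ c)) (fun c => G (σ c))| ≤
        M * h ^ (2 * s) := by
  have hAG : ContDiff ℝ ∞ fun x => A x (G x) := hA.clm_apply hG
  obtain ⟨P, hP0, hP⟩ := exists_norm_sub_proj_le (E := E) hsk
  obtain ⟨M₁, h₁0, h₁⟩ := exists_norm_iteratedDeriv_comp_le hκ s hD R
  obtain ⟨M₂, h₂0, h₂⟩ := exists_norm_iteratedDeriv_comp_le hG s hD R
  obtain ⟨M₃, h₃0, h₃⟩ := exists_norm_iteratedDeriv_comp_le hAG s hD R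
  obtain ⟨M₄, h₄0, h₄⟩ := exists_norm_iteratedFDeriv_le hA R 0
  refine ⟨quadNorm k 1 * (P * M₁ * (M₄ * (P * M₂) + P * M₃)),
    mul_nonneg (quadNorm_nonneg _ _) (by positivity), fun t σ ht hσ => ?_⟩
  have hsm : ∀ {f : E → E}, ContDiff ℝ ∞ f → ContDiff ℝ s fun c => f (σ c) := fun hf =>
    (hf.comp hσ.contDiff).of_le (by exact_mod_cast le_top)
  rw [numerator_eq_quad_sub_proj hsk _ fun c y => h (σ c) y, ← Real.norm_eq_abs, mul_assoc]
  refine norm_quad_le fun c hc => ?_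
  have hc := mem_Icc_of_mem_nodes hc
  have e₁ := hP (hsm hκ) (h₁ t σ ht hσ s le_rfl) c hc
  have e₂ := hP (hsm hG) (h₂ t σ ht hσ s le_rfl) c hc
  have e₃ := hP (hsm hAG) (h₃ t σ ht hσ s le_rfl) c hc
  have e₄ := h₄ 0 le_rfl (σ c) (hσ.norm_le c hc)
  rw [norm_iteratedFDeriv_zero] at e₄
  calc _ ≤ (P * (M₁ * t ^ s)) * (M₄ * (P * (M₂ * t ^ s)) + P * (M₃ * t ^ s)) := by
        refine (norm_inner_le_norm _ _).trans (mul_le_mul e₁ ?_ (norm_nonneg _) (by positivity))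
        refine (norm_sub_le _ _).trans (add_le_add ?_ e₃)
        exact (ContinuousLinearMap.le_opNorm _ _).trans
          (mul_le_mul e₄ e₂ (norm_nonneg _) h₄0)
    _ = _ := by ring

/-- A crude bound that uses no information on the derivatives. -/
theorem exists_abs_numerator_le_const [ProperSpace E] (k s : ℕ) {κ G : E → E}
    {A : E → E →L[ℝ] E} (hκ : ContDiff ℝ ∞ κ) (hA : ContDiff ℝ ∞ A) (hG : ContDiff ℝ ∞ G)
    (R : ℝ) : ∃ M, 0 ≤ M ∧ ∀ σ : ℝ → E, (∀ c ∈ Set.Icc (0 : ℝ) 1, ‖σ c‖ ≤ R) →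
      |numerator k s (fun c => κ (σ c)) (fun c => A (σ c)) (fun c => G (σ c))| ≤ M := by
  obtain ⟨M₁, h₁0, h₁⟩ := exists_norm_iteratedFDeriv_le hκ R 0
  obtain ⟨M₂, h₂0, h₂⟩ := exists_norm_iteratedFDeriv_le hA R 0
  obtain ⟨M₃, h₃0, h₃⟩ := exists_norm_iteratedFDeriv_le hG R 0
  simp only [nonpos_iff_eq_zero, forall_eq, norm_iteratedFDeriv_zero] at h₁ h₂ h₃
  refine ⟨∑ i ∈ Finset.range s, ∑ j ∈ Finset.range s, quadNorm k (legendre i) * M₁ *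
    ((quadNorm k (legendre i * legendre j) * M₂) * (quadNorm k (legendre j) * M₃)),
    Finset.sum_nonneg fun i _ => Finset.sum_nonneg fun j _ => ?_, fun σ hσ => ?_⟩
  · have := quadNorm_nonneg k (legendre i)
    have := quadNorm_nonneg k (legendre j)
    have := quadNorm_nonneg k (legendre i * legendre j)
    positivity
  rw [← Real.norm_eq_abs, numerator]
  refine norm_sum_le_of_le _ fun i _ => norm_sum_le_of_le _ fun j _ => ?_
  have hn : ∀ c ∈ nodes k, ‖σ c‖ ≤ R := fun c hc => hσ c (mem_Icc_of_mem_nodes hc)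
  have e₁ : ‖coeff k (fun c => κ (σ c)) i‖ ≤ _ :=
    norm_quad_smul_le (legendre i) fun c hc => h₁ _ (hn c hc)
  have e₂ : ‖coeff₂ k (fun c => A (σ c)) i j‖ ≤ quadNorm k (legendre i * legendre j) * M₂ := by
    have := norm_quad_smul_le (legendre i * legendre j) fun c hc => h₂ _ (hn c hc)
    simpa only [eval_mul, coeff₂] using this
  have e₃ : ‖coeff k (fun c => G (σ c)) j‖ ≤ _ :=
    norm_quad_smul_le (legendre j) fun c hc => h₃ _ (hn c hc)
  refine (norm_inner_le_norm _ _).trans (mul_le_mul e₁ ?_ (norm_nonneg _)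
    ((norm_nonneg _).trans e₁))
  exact (ContinuousLinearMap.le_opNorm _ _).trans
    (mul_le_mul e₂ e₃ (norm_nonneg _) ((norm_nonneg _).trans e₂))

end Numerator

/-! ### Error bounds for the collocation equation -/

section Abstract

variable {E : Type*} [NormedAddCommGroup E] [InnerProductSpace ℝ E]

theorem sum_inner_stageCoeff {k s : ℕ} (hs : 1 ≤ s) (A : E → E →L[ℝ] E) (G : E → E)
    (T : E →L[ℝ] E) (κ : ℝ → E) (σ : ℝ → E) (α : ℝ) :
    ∑ i ∈ Finset.range s, inner ℝ (coeff k κ i) (stageCoeff k s A G T σ α i) =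
      numerator k s κ (fun c => A (σ c)) (fun c => G (σ c)) -
        α * inner ℝ (coeff k κ 0) (T (coeff k (fun c => G (σ c)) 0)) := by
  simp only [stageCoeff, inner_sub_right, inner_sum, Finset.sum_sub_distrib, numerator]
  congr 1
  rw [Finset.sum_eq_single 0]
  · simp [inner_smul_right]
  · intro i _ hi
    simp [hi]
  · intro h
    exact absurd (Finset.mem_range.mpr hs) h

theorem exists_abs_sub_le [CompleteSpace E] [ProperSpace E] {k s : ℕ} (hsk : s ≤ k)
    {A : E → E →L[ℝ] E} (hA : ContDiff ℝ ∞ A) {G : E → E} (hG : ContDiff ℝ ∞ G) {C : E → ℝ}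
    (hC : ContDiff ℝ ∞ C) (T : E →L[ℝ] E) (R K : ℝ) :
    ∃ M, ∀ (h α : ℝ) (σ : ℝ → E), 0 ≤ h → h ≤ 1 → |α| ≤ K →
      (∀ c ∈ Set.Icc (0 : ℝ) 1, ‖σ c‖ ≤ R) →
      IsExpansion s (stageCoeff k s A G T σ α) h σ →
      ∑ i ∈ Finset.range s, inner ℝ (coeff k (fun c => gradient C (σ c)) i)
        (stageCoeff k s A G T σ α i) = 0 →
      |C (σ 1) - C (σ 0)| ≤ M * h ^ (2 * k + 1) := by
  obtain ⟨D, hD, hslow⟩ := exists_slowCurve hsk hA hG T R K (2 * k + 1)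
  obtain ⟨M, -, hM⟩ := exists_norm_iteratedDeriv_comp_le hC (2 * k + 1) hD R
  refine ⟨(1 + quadNorm k 1) * M, fun h α σ hh hh1 hα hR hσ horth => ?_⟩
  exact abs_sub_le_of_sum_inner_eq_zero hC k hσ horth
    (hM h σ hh (hslow h α σ hh hh1 hα hR hσ) _ le_rfl)

/-- As `P_0 = 1` and `k ≥ 1`, the weights sum to one, so the coefficient reproduces constants. -/
theorem norm_coeff_zero_sub_le {k : ℕ} (hk : 1 ≤ k) {f : ℝ → E} {e : E} {ε : ℝ}
    (hf : ∀ c ∈ Set.Icc (0 : ℝ) 1, ‖f c - e‖ ≤ ε) : ‖coeff k f 0 - e‖ ≤ quadNorm k 1 * ε := by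
  have h1 : quad k (fun _ => e) = e := by
    have h2 := quad_smul_const (k := k) (fun c => (legendre 0).eval c * (legendre 0).eval c) e
    rw [quad_legendre_mul_legendre (by omega), if_pos rfl, one_smul] at h2
    simpa [legendre_zero] using h2
  have h3 := norm_quad_le (k := k) fun c hc => hf c (mem_Icc_of_mem_nodes hc)
  rw [quad_sub, h1] at h3
  simpa [coeff, legendre_zero] using h3

theorem exists_le_abs_inner_coeff_zero {k : ℕ} (hk : 1 ≤ k) {κ G : E → E} (hκ : Continuous κ)
    (hG : Continuous G) (T : E →L[ℝ] E) {y₀ : E} (h0 : inner ℝ (κ y₀) (T (G y₀)) ≠ (0 : ℝ)) :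
    ∃ r δ : ℝ, 0 < r ∧ 0 < δ ∧ ∀ σ : ℝ → E, (∀ c ∈ Set.Icc (0 : ℝ) 1, ‖σ c - y₀‖ ≤ r) →
      δ ≤ |inner ℝ (coeff k (fun c => κ (σ c)) 0) (T (coeff k (fun c => G (σ c)) 0))| := by
  set φ : E × E → ℝ := fun x => |inner ℝ x.1 (T x.2)| with hφ
  have hφc : Continuous φ := by fun_prop
  have hpos : 0 < φ (κ y₀, G y₀) := abs_pos.mpr h0
  obtain ⟨η, hη, hball⟩ := Metric.eventually_nhds_iff.mp
    (hφc.continuousAt.eventually_const_lt (half_lt_self hpos))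
  -- Adding `1` makes the divisor positive and the final inequality strict.
  have hW : 0 < quadNorm k 1 + 1 := by linarith [quadNorm_nonneg k 1]
  have hε : 0 < η / (quadNorm k 1 + 1) := by positivity
  obtain ⟨r₁, hr₁, h₁⟩ := Metric.continuousAt_iff.mp (hκ.continuousAt (x := y₀)) _ hε
  obtain ⟨r₂, hr₂, h₂⟩ := Metric.continuousAt_iff.mp (hG.continuousAt (x := y₀)) _ hε
  refine ⟨min r₁ r₂ / 2, φ (κ y₀, G y₀) / 2, by positivity, by positivity, fun σ hσ => ?_⟩
  have hlt : ∀ c ∈ Set.Icc (0 : ℝ) 1, dist (σ c) y₀ < min r₁ r₂ := fun c hc => by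
    rw [dist_eq_norm]
    exact (hσ c hc).trans_lt (half_lt_self (by positivity))
  have key : ∀ {f : E → E} {x : E}, (∀ c ∈ Set.Icc (0 : ℝ) 1,
      dist (f (σ c)) x < η / (quadNorm k 1 + 1)) → dist (coeff k (fun c => f (σ c)) 0) x < η := by
    intro f x hf
    rw [dist_eq_norm]
    have hle : ∀ c ∈ Set.Icc (0 : ℝ) 1, ‖f (σ c) - x‖ ≤ η / (quadNorm k 1 + 1) := fun c hc => by
      rw [← dist_eq_norm]
      exact (hf c hc).le
    refine (norm_coeff_zero_sub_le hk hle).trans_lt ?_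
    rw [← mul_div_assoc, div_lt_iff₀ hW]
    linarith
  have h3 := key fun c hc => h₁ ((hlt c hc).trans_le (min_le_left _ _))
  have h4 := key fun c hc => h₂ ((hlt c hc).trans_le (min_le_right _ _))
  exact (hball (y := (coeff k (fun c => κ (σ c)) 0, coeff k (fun c => G (σ c)) 0))
    (by rw [Prod.dist_eq]; exact max_lt h3 h4)).le

theorem exists_abs_alpha_le [ProperSpace E] {k s : ℕ} (hs : 1 ≤ s) (hsk : s ≤ k)
    {κ G : E → E} {A : E → E →L[ℝ] E} (hκ : ContDiff ℝ ∞ κ) (hA : ContDiff ℝ ∞ A)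
    (hG : ContDiff ℝ ∞ G) (T : E →L[ℝ] E) (hcas : ∀ x y, inner ℝ (κ x) (A x y) = (0 : ℝ))
    {y₀ : E} (h0 : inner ℝ (κ y₀) (T (G y₀)) ≠ (0 : ℝ)) :
    ∃ r K M : ℝ, 0 < r ∧ ∀ (h α : ℝ) (σ : ℝ → E), 0 ≤ h → h ≤ 1 →
      (∀ c ∈ Set.Icc (0 : ℝ) 1, ‖σ c - y₀‖ ≤ r) →
      IsExpansion s (stageCoeff k s A G T σ α) h σ →
      α = numerator k s (fun c => κ (σ c)) (fun c => A (σ c)) (fun c => G (σ c)) /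
        inner ℝ (coeff k (fun c => κ (σ c)) 0) (T (coeff k (fun c => G (σ c)) 0)) →
      |α| ≤ K ∧ |α| ≤ M * h ^ (2 * s) := by
  obtain ⟨r, δ, hr, hδ, hden⟩ :=
    exists_le_abs_inner_coeff_zero (hs.trans hsk) hκ.continuous hG.continuous T h0
  -- The slow-curve estimate presupposes a bound on `α`. The crude bound `M₀ / δ` supplies it
  -- without derivative information and so avoids circularity.
  obtain ⟨M₀, hM₀0, hM₀⟩ := exists_abs_numerator_le_const k s hκ hA hG (‖y₀‖ + r)
  obtain ⟨D, hD, hslow⟩ := exists_slowCurve hsk hA hG T (‖y₀‖ + r) (M₀ / δ) s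
  obtain ⟨M, hM0, hM⟩ := exists_abs_numerator_le hsk hκ hA hG hcas hD (‖y₀‖ + r)
  refine ⟨r, M₀ / δ, M / δ, hr, fun h α σ hh hh1 hσr hσ hα => ?_⟩
  have hR : ∀ c ∈ Set.Icc (0 : ℝ) 1, ‖σ c‖ ≤ ‖y₀‖ + r := fun c hc => by
    have := norm_add_le y₀ (σ c - y₀)
    rw [add_sub_cancel] at this
    linarith [hσr c hc]
  have hd := hden σ hσr
  have hK : |α| ≤ M₀ / δ := by
    rw [hα, abs_div]
    exact div_le_div₀ hM₀0 (hM₀ σ hR) hδ hd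
  refine ⟨hK, ?_⟩
  rw [hα, abs_div, div_mul_eq_mul_div]
  exact div_le_div₀ (by positivity) (hM h σ hh (hslow h α σ hh hh1 hK hR hσ)) hδ hd

end Abstract

/-! ### The method in Euclidean space -/

section Euclidean

theorem exists_derivative_eq (p : ℝ[X]) :
    ∃ q : ℝ[X], derivative q = p ∧ q.eval 0 = 0 ∧ q.natDegree ≤ p.natDegree + 1 := by
  refine ⟨∑ l ∈ Finset.range (p.natDegree + 1),
    Polynomial.C (p.coeff l / ((l : ℝ) + 1)) * X ^ (l + 1), ?_, ?_, ?_⟩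
  · conv_rhs => rw [p.as_sum_range_C_mul_X_pow]
    rw [derivative_sum]
    refine Finset.sum_congr rfl fun l _ => ?_
    have : (l : ℝ) + 1 ≠ 0 := by positivity
    rw [derivative_C_mul_X_pow]
    simp [div_mul_cancel₀ _ this]
  · simp [eval_finsetSum]
  · refine natDegree_sum_le_of_forall_le _ _ fun l hl => ?_
    have := Finset.mem_range.mp hl
    exact (natDegree_C_mul_X_pow_le _ _).trans (by omega)

variable {m : ℕ}

theorem contDiff_toEuclideanCLM {B : EuclideanSpace ℝ (Fin m) → Matrix (Fin m) (Fin m) ℝ}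
    (hB : ∀ i j, ContDiff ℝ ∞ fun y => B y i j) :
    ContDiff ℝ ∞ fun y => Matrix.toEuclideanCLM (𝕜 := ℝ) (B y) := by
  have h : (fun y => Matrix.toEuclideanCLM (𝕜 := ℝ) (B y)) = fun y => ∑ i, ∑ j,
      B y i j • Matrix.toEuclideanCLM (𝕜 := ℝ) (Matrix.single i j (1 : ℝ)) := by
    funext y
    conv_lhs => rw [Matrix.matrix_eq_sum_single (B y)]
    simp only [map_sum, ← map_smul, Matrix.smul_single, smul_eq_mul, mul_one]
  rw [h]
  exact ContDiff.sum fun i _ => ContDiff.sum fun j _ => (hB i j).smul contDiff_const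

theorem inner_toEuclideanCLM_eq_zero {M : Matrix (Fin m) (Fin m) ℝ}
    {x : EuclideanSpace ℝ (Fin m)} (h : Matrix.vecMul x.ofLp M = 0)
    (y : EuclideanSpace ℝ (Fin m)) :
    inner ℝ x (Matrix.toEuclideanCLM (𝕜 := ℝ) M y) = (0 : ℝ) := by
  rw [Matrix.inner_toEuclideanCLM, Matrix.dotProduct_mulVec, h, zero_dotProduct]

theorem toEuclideanLin_matCoeff (k : ℕ)
    (B : EuclideanSpace ℝ (Fin m) → Matrix (Fin m) (Fin m) ℝ) (h : ℝ)
    (u : ℝ → EuclideanSpace ℝ (Fin m)) (i j : ℕ) (x : EuclideanSpace ℝ (Fin m)) :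
    Matrix.toEuclideanLin (matCoeff k B h u i j) x =
      coeff₂ k (fun c => Matrix.toEuclideanCLM (𝕜 := ℝ) (B (u (c * h)))) i j x := by
  have h1 : coeff₂ k (fun c => Matrix.toEuclideanCLM (𝕜 := ℝ) (B (u (c * h)))) i j =
      Matrix.toEuclideanCLM (𝕜 := ℝ) (matCoeff k B h u i j) := by
    rw [matCoeff, map_quad]
    simp only [coeff₂, map_smul]
  rw [h1]
  rfl

/-- A polynomial curve with the prescribed expansion of its derivative. -/
theorem exists_isExpansion (s : ℕ) (v : ℕ → EuclideanSpace ℝ (Fin m)) (h : ℝ)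
    (y₀ : EuclideanSpace ℝ (Fin m)) : ∃ (σ : ℝ → EuclideanSpace ℝ (Fin m)) (p : Fin m → ℝ[X]),
      IsExpansion s v h σ ∧ σ 0 = y₀ ∧ ∀ l, (p l).natDegree ≤ s ∧ ∀ c, σ c l = (p l).eval c := by
  choose q hq hq0 hqd using fun i => exists_derivative_eq (legendre i)
  refine ⟨fun c => y₀ + h • ∑ i ∈ Finset.range s, (q i).eval c • v i,
    fun l => Polynomial.C (y₀ l) +
      Polynomial.C h * ∑ i ∈ Finset.range s, q i * Polynomial.C (v i l), ?_, ?_, ?_⟩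
  · intro c
    refine ((HasDerivAt.fun_sum fun i _ => ?_).const_smul h).const_add y₀
    have := (q i).hasDerivAt c
    rw [hq] at this
    exact this.smul_const (v i)
  · simp [hq0]
  · refine fun l => ⟨?_, fun c => by simp [eval_finsetSum]⟩
    refine natDegree_add_le_of_degree_le (by simp) ((natDegree_C_mul_le _ _).trans ?_)
    refine natDegree_sum_le_of_forall_le _ _ fun i hi => (natDegree_mul_C_le _ _).trans ?_
    have h1 := hqd i
    rw [natDegree_legendre] at h1
    have := Finset.mem_range.mp hi
    omega

/-- A step of the method is a polynomial of degree at most `s` that solves the collocation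
equation in the rescaled time. -/
theorem IsStep.exists_isExpansion {k s : ℕ} (hs : 1 ≤ s)
    {B : EuclideanSpace ℝ (Fin m) → Matrix (Fin m) (Fin m) ℝ}
    {H C : EuclideanSpace ℝ (Fin m) → ℝ} {Bt : Matrix (Fin m) (Fin m) ℝ}
    {y₀ : EuclideanSpace ℝ (Fin m)} {h : ℝ} {u : ℝ → EuclideanSpace ℝ (Fin m)} {α : ℝ}
    (hh : 0 < h) (hu : IsStep k s B H C Bt y₀ h u α) :
    ∃ (σ : ℝ → EuclideanSpace ℝ (Fin m)) (p : Fin m → ℝ[X]),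
      (∀ l, (p l).natDegree ≤ s ∧ ∀ c, σ c l = (p l).eval c) ∧
      (∀ c ∈ Set.Icc (0 : ℝ) 1, u (c * h) = σ c) ∧
      IsExpansion s (stageCoeff k s (fun y => Matrix.toEuclideanCLM (𝕜 := ℝ) (B y)) (gradient H)
        (Matrix.toEuclideanCLM (𝕜 := ℝ) Bt) σ α) h σ ∧
      inner ℝ (coeff k (fun c => gradient C (σ c)) 0)
        (Matrix.toEuclideanCLM (𝕜 := ℝ) Bt (coeff k (fun c => gradient H (σ c)) 0)) ≠ (0 : ℝ) ∧
      α = numerator k s (fun c => gradient C (σ c))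
          (fun c => Matrix.toEuclideanCLM (𝕜 := ℝ) (B (σ c))) (fun c => gradient H (σ c)) /
        inner ℝ (coeff k (fun c => gradient C (σ c)) 0)
          (Matrix.toEuclideanCLM (𝕜 := ℝ) Bt (coeff k (fun c => gradient H (σ c)) 0)) := by
  set w : ℝ → EuclideanSpace ℝ (Fin m) := fun c => u (c * h) with hw
  set v := stageCoeff k s (fun y => Matrix.toEuclideanCLM (𝕜 := ℝ) (B y)) (gradient H)
        (Matrix.toEuclideanCLM (𝕜 := ℝ) Bt) w α with hv
  -- The solution is known only on `[0,h]`; this polynomial, built from its coefficients, extends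
  -- the rescaled solution to all of `ℝ`.
  obtain ⟨σ, p, hσ, hσ0, hp⟩ := EPHBVM.exists_isExpansion s v h y₀
  have hode : ∀ c ∈ Set.Icc (0 : ℝ) 1, HasDerivWithinAt w
      (h • ∑ i ∈ Finset.range s, (legendre i).eval c • v i) (Set.Icc 0 1) c := by
    intro c hc
    have hmaps : Set.MapsTo (fun x : ℝ => x * h) (Set.Icc 0 1) (Set.Icc 0 h) := fun x hx =>
      ⟨mul_nonneg hx.1 hh.le, mul_le_of_le_one_left hh.le hx.2⟩
    have h1 := (hu.ode c hc).scomp c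
      (((hasDerivAt_id c).mul_const h).hasDerivWithinAt (s := Set.Icc 0 1)) hmaps
    rw [one_mul] at h1
    have h2 : ∑ i ∈ Finset.range s, (legendre i).eval c • v i =
        (∑ i ∈ Finset.range s, ∑ j ∈ Finset.range s, (legendre i).eval c •
          Matrix.toEuclideanLin (matCoeff k B h u i j) (gradCoeff k H h u j))
        - α • Matrix.toEuclideanLin Bt (gradCoeff k H h u 0) := by
      simp only [hv, stageCoeff, smul_sub, Finset.sum_sub_distrib, Finset.smul_sum]
      congr 1
      · exact Finset.sum_congr rfl fun i _ => Finset.sum_congr rfl fun j _ => by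
          rw [toEuclideanLin_matCoeff]
          rfl
      · rw [Finset.sum_eq_single 0]
        · simp only [if_true, legendre_zero, eval_one, one_smul]
          rfl
        · intro i _ hi
          simp [hi]
        · intro h0
          exact absurd (Finset.mem_range.mpr hs) h0
    rw [h2]
    exact h1
  have huσ : ∀ c ∈ Set.Icc (0 : ℝ) 1, w c = σ c := by
    intro c hc
    -- The difference has zero derivative on `[0,1]` and vanishes at `0`.
    have h1 := (convex_Icc (0 : ℝ) 1).norm_image_sub_le_of_norm_hasDerivWithin_le (C := 0)
      (f := fun c => w c - σ c) (f' := fun _ => 0)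
      (fun x hx => by simpa using (hode x hx).fun_sub (hσ x).hasDerivWithinAt)
      (by simp) (Set.left_mem_Icc.mpr zero_le_one) hc
    rw [zero_mul] at h1
    have h2 := sub_eq_zero.mp (norm_le_zero_iff.mp h1)
    have h3 : w 0 = y₀ := by simp [hw, hu.init]
    rwa [h3, hσ0, sub_self, sub_eq_zero] at h2
  have e₁ : ∀ (f : EuclideanSpace ℝ (Fin m) → EuclideanSpace ℝ (Fin m)) i,
      coeff k (fun c => f (w c)) i = coeff k (fun c => f (σ c)) i := fun f i =>
    quad_congr fun c hc => by simp only [huσ c hc]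
  have e₂ : ∀ i j, coeff₂ k (fun c => Matrix.toEuclideanCLM (𝕜 := ℝ) (B (w c))) i j =
      coeff₂ k (fun c => Matrix.toEuclideanCLM (𝕜 := ℝ) (B (σ c))) i j := fun i j =>
    quad_congr fun c hc => by simp only [huσ c hc]
  have hvσ : v = stageCoeff k s (fun y => Matrix.toEuclideanCLM (𝕜 := ℝ) (B y)) (gradient H)
      (Matrix.toEuclideanCLM (𝕜 := ℝ) Bt) σ α := by
    funext i
    simp only [hv, stageCoeff, e₁, e₂]
  have hden := hu.den_ne_zero
  have hα := hu.alpha_eq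
  simp only [toEuclideanLin_matCoeff] at hα
  change inner ℝ (coeff k (fun c => gradient C (w c)) 0) (Matrix.toEuclideanCLM (𝕜 := ℝ) Bt
    (coeff k (fun c => gradient H (w c)) 0)) ≠ (0 : ℝ) at hden
  change α = numerator k s (fun c => gradient C (w c))
    (fun c => Matrix.toEuclideanCLM (𝕜 := ℝ) (B (w c))) (fun c => gradient H (w c)) /
      inner ℝ (coeff k (fun c => gradient C (w c)) 0) (Matrix.toEuclideanCLM (𝕜 := ℝ) Bt
        (coeff k (fun c => gradient H (w c)) 0)) at hα
  simp only [numerator, e₁, e₂] at hden hα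
  exact ⟨σ, p, hp, huσ, hvσ ▸ hσ, hden, hα⟩

theorem sum_inner_stageCoeff_eq_zero {E : Type*} [NormedAddCommGroup E] [InnerProductSpace ℝ E]
    {k s : ℕ} (hs : 1 ≤ s) {A : E → E →L[ℝ] E} {G κ : E → E} {T : E →L[ℝ] E} {σ : ℝ → E} {α : ℝ}
    (hden : inner ℝ (coeff k (fun c => κ (σ c)) 0) (T (coeff k (fun c => G (σ c)) 0)) ≠ (0 : ℝ))
    (hα : α = numerator k s (fun c => κ (σ c)) (fun c => A (σ c)) (fun c => G (σ c)) /
        inner ℝ (coeff k (fun c => κ (σ c)) 0) (T (coeff k (fun c => G (σ c)) 0))) :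
    ∑ i ∈ Finset.range s, inner ℝ (coeff k (fun c => κ (σ c)) i)
      (stageCoeff k s A G T σ α i) = 0 := by
  rw [sum_inner_stageCoeff hs, hα, div_mul_cancel₀ _ hden, sub_self]

/-- Along a curve of degree at most `s`, `C` is a polynomial of degree at most `2k`, so the Gauss
rule integrates its derivative exactly. -/
theorem sub_eq_zero_of_polynomial {k s : ℕ} {C : EuclideanSpace ℝ (Fin m) → ℝ}
    (hC : ContDiff ℝ ∞ C) {P : MvPolynomial (Fin m) ℝ} (hP : P.totalDegree * s ≤ 2 * k)
    (hCP : ∀ y : EuclideanSpace ℝ (Fin m), C y = MvPolynomial.eval y.ofLp P)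
    {v : ℕ → EuclideanSpace ℝ (Fin m)} {h : ℝ} {σ : ℝ → EuclideanSpace ℝ (Fin m)}
    {p : Fin m → ℝ[X]} (hp : ∀ l, (p l).natDegree ≤ s ∧ ∀ c, σ c l = (p l).eval c)
    (hσ : IsExpansion s v h σ)
    (horth : ∑ i ∈ Finset.range s, inner ℝ (coeff k (fun c => gradient C (σ c)) i) (v i) = 0) :
    C (σ 1) - C (σ 0) = 0 := by
  set Q : ℝ[X] := MvPolynomial.aeval p P with hQ
  have hQd : Q.natDegree ≤ 2 * k :=
    (MvPolynomial.aeval_natDegree_le P le_rfl p fun l => (hp l).1).trans hP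
  have hCQ : (fun c => C (σ c)) = fun c => Q.eval c := by
    funext c
    have h1 : (σ c).ofLp = fun l => (p l).eval c := funext fun l => (hp l).2 c
    have h2 := MvPolynomial.comp_aeval_apply (f := p) (aeval (R := ℝ) c) P
    rw [MvPolynomial.aeval_eq_eval] at h2
    rw [hCP, h1]
    exact h2.symm
  have hderiv : deriv (fun c => C (σ c)) = fun c => (derivative Q).eval c := by
    rw [hCQ]
    funext c
    exact Polynomial.deriv Q
  have hdeg : (derivative Q).degree < (2 * k : ℕ) := by
    by_cases h0 : Q.natDegree = 0
    · rw [eq_C_of_natDegree_eq_zero h0, derivative_C, degree_zero]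
      exact WithBot.bot_lt_coe _
    · refine degree_le_natDegree.trans_lt ?_
      exact_mod_cast (natDegree_derivative_lt h0).trans_le hQd
  have h1 := quad_deriv_comp hC k hσ
  rw [horth, mul_zero, hderiv, quad_eval hdeg] at h1
  rw [← integral_deriv_comp hC hσ, hderiv]
  exact h1

end Euclidean

end EPHBVM

end

theorem mainTheorem11 {m k s : ℕ} (hs : 1 ≤ s) (hsk : s ≤ k)
    (B : EuclideanSpace ℝ (Fin m) → Matrix (Fin m) (Fin m) ℝ)
    (H C : EuclideanSpace ℝ (Fin m) → ℝ)
    (Bt : Matrix (Fin m) (Fin m) ℝ) (y₀ : EuclideanSpace ℝ (Fin m))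
    (hB : ∀ i j, ContDiff ℝ ∞ fun y => B y i j)
    (hH : ContDiff ℝ ∞ H) (hC : ContDiff ℝ ∞ C)
    (hBskew : ∀ y, (B y).transpose = -B y)
    (hCas : ∀ y, Matrix.vecMul (gradient C y).ofLp (B y) = 0)
    (hBt : Bt.transpose = -Bt) (hBt0 : Bt ≠ 0) :
    -- exact conservation for a polynomial Casimir of degree at most `2k/s`
    ((∃ p : MvPolynomial (Fin m) ℝ, (p.totalDegree : ℝ) ≤ 2 * (k : ℝ) / (s : ℝ) ∧
        ∀ y : EuclideanSpace ℝ (Fin m), C y = MvPolynomial.eval y.ofLp p) →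
      ∀ (h : ℝ) (u : ℝ → EuclideanSpace ℝ (Fin m)) (α : ℝ), 0 < h →
        EPHBVM.IsStep k s B H C Bt y₀ h u α → C (u h) - C y₀ = 0) ∧
    -- Casimir error `O(h^(2k+1))`, uniformly over all bounded solutions
    (∀ R K : ℝ, ∃ M h₀ : ℝ, 0 < h₀ ∧
      ∀ (h : ℝ) (u : ℝ → EuclideanSpace ℝ (Fin m)) (α : ℝ), 0 < h → h ≤ h₀ →
        EPHBVM.IsStep k s B H C Bt y₀ h u α →
        (∀ t ∈ Set.Icc 0 h, ‖u t‖ ≤ R) → |α| ≤ K →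
        |C (u h) - C y₀| ≤ M * h ^ (2 * k + 1)) ∧
    -- with a denominator bounded away from zero, `α = O(h^(2s))` and the error bound hold for
    -- all solutions that stay near `y₀`, without any prior bound on `α`
    (inner ℝ (gradient C y₀) (Matrix.toEuclideanLin Bt (gradient H y₀)) ≠ 0 →
      ∃ r M h₀ : ℝ, 0 < r ∧ 0 < h₀ ∧
        ∀ (h : ℝ) (u : ℝ → EuclideanSpace ℝ (Fin m)) (α : ℝ), 0 < h → h ≤ h₀ →
          EPHBVM.IsStep k s B H C Bt y₀ h u α →
          (∀ t ∈ Set.Icc 0 h, ‖u t - y₀‖ ≤ r) →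
          |α| ≤ M * h ^ (2 * s) ∧ |C (u h) - C y₀| ≤ M * h ^ (2 * k + 1)) := by
  have hA := EPHBVM.contDiff_toEuclideanCLM hB
  have hG := EPHBVM.contDiff_gradient hH
  have hκ := EPHBVM.contDiff_gradient hC
  have hends : ∀ {h : ℝ} {u σ : ℝ → EuclideanSpace ℝ (Fin m)} {α : ℝ},
      EPHBVM.IsStep k s B H C Bt y₀ h u α → (∀ c ∈ Set.Icc (0 : ℝ) 1, u (c * h) = σ c) →
        C (u h) - C y₀ = C (σ 1) - C (σ 0) := by
    intro h u σ α hu huσ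
    rw [← huσ 1 (by simp), ← huσ 0 (by simp), one_mul, zero_mul, hu.init]
  have hmem : ∀ {h c : ℝ}, 0 < h → c ∈ Set.Icc (0 : ℝ) 1 → c * h ∈ Set.Icc 0 h :=
    fun hh hc => ⟨mul_nonneg hc.1 hh.le, mul_le_of_le_one_left hh.le hc.2⟩
  refine ⟨?_, fun R K => ?_, fun h0 => ?_⟩
  · rintro ⟨P, hPd, hP⟩ h u α hh hu
    obtain ⟨σ, p, hp, huσ, hσ, hden, hα⟩ := hu.exists_isExpansion hs hh
    rw [hends hu huσ]
    refine EPHBVM.sub_eq_zero_of_polynomial hC ?_ hP hp hσ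
      (EPHBVM.sum_inner_stageCoeff_eq_zero hs hden hα)
    rw [le_div_iff₀ (by exact_mod_cast hs)] at hPd
    exact_mod_cast hPd
  · obtain ⟨M, hM⟩ := EPHBVM.exists_abs_sub_le hsk hA hG hC
      (Matrix.toEuclideanCLM (𝕜 := ℝ) Bt) R K
    -- The estimates are uniform for `h ≤ 1`, so `h₀ = 1` serves.
    refine ⟨M, 1, one_pos, fun h u α hh hh1 hu hR hK => ?_⟩
    obtain ⟨σ, p, hp, huσ, hσ, hden, hα⟩ := hu.exists_isExpansion hs hh
    rw [hends hu huσ]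
    exact hM h α σ hh.le hh1 hK (fun c hc => huσ c hc ▸ hR _ (hmem hh hc)) hσ
      (EPHBVM.sum_inner_stageCoeff_eq_zero hs hden hα)
  · obtain ⟨r, K, M₁, hr, h₁⟩ := EPHBVM.exists_abs_alpha_le hs hsk hκ hA hG
      (Matrix.toEuclideanCLM (𝕜 := ℝ) Bt)
      (fun x y => EPHBVM.inner_toEuclideanCLM_eq_zero (hCas x) y) h0
    -- The ball of radius `r` about `y₀` lies in the one of radius `‖y₀‖ + r` about `0`, and `K` is
    -- the bound on `α` just derived.
    obtain ⟨M₂, h₂⟩ := EPHBVM.exists_abs_sub_le hsk hA hG hC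
      (Matrix.toEuclideanCLM (𝕜 := ℝ) Bt) (‖y₀‖ + r) K
    refine ⟨r, max M₁ M₂, 1, hr, one_pos, fun h u α hh hh1 hu hur => ?_⟩
    obtain ⟨σ, p, hp, huσ, hσ, hden, hα⟩ := hu.exists_isExpansion hs hh
    have hσr : ∀ c ∈ Set.Icc (0 : ℝ) 1, ‖σ c - y₀‖ ≤ r := fun c hc =>
      huσ c hc ▸ hur _ (hmem hh hc)
    obtain ⟨hK, hαM⟩ := h₁ h α σ hh.le hh1 hσr hσ hα
    refine ⟨hαM.trans (by gcongr; exact le_max_left _ _), ?_⟩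
    rw [hends hu huσ]
    refine (h₂ h α σ hh.le hh1 hK (fun c hc => ?_) hσ
      (EPHBVM.sum_inner_stageCoeff_eq_zero hs hden hα)).trans (by gcongr; exact le_max_right _ _)
    have := norm_add_le y₀ (σ c - y₀)
    rw [add_sub_cancel] at this
    linarith [hσr c hc]
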